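/- Let $N,m\ge 1$. Let $(\omega_k)_{k\in K}$ be a family of vectors in $\mathbb R^N$ with $\gamma:=\inf_{k\ne n}|\omega_k-\omega_n|>0$, and let $K=K_1\cup\dots\cup K_m$ be a finite partition of $K$. Put $$\gamma_j:=\inf\{|\omega_k-\omega_n| : k,n\in K_j,\ k\ne n\},\qquad j=1,\dots,m,$$ with $\inf\varnothing=+\infty$. Let $B_R$ be the open ball of radius $R$ in $\mathbb R^N$ centered at the origin, let $\mu$ be the first eigenvalue of $-\Delta$ in the Sobolev space $H_0^1(B_1)$, and set $$R_j:=\frac{2\sqrt\mu}{\gamma_j}\quad(R_j:=0\text{ if }\gamma_j=+\infty),\qquad R_0:=R_1+\dots+R_m.$$ Then there exist two positive constants $c_1$ and $c_2$, depending only on $N$, $\gamma$, $m$ and $\gamma_1,\dots,\gamma_m$, such that if $R_0<R\le 2R_0$, then for every square summable family $(x_k)_{k\in K}$ of complex numbers the series $\sum_{k\in K}x_ke^{i\omega_k\cdot t}$ converges unconditionally in $L^2(B_R)$ and $$c_1(R-R_0)^{5m-4+2N}\sum_{k\in K}|x_k|^2\le\int_{B_R}\Bigl|\sum_{k\in K}x_ke^{i\omega_k\cdot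 t}\Bigr|^2\,dt\le c_2\sum_{k\in K}|x_k|^2 .$$ -/

import Mathlib

open MeasureTheory Filter Topology Metric
open scoped ENNReal

noncomputable section

/-- Smooth real-valued functions with compact support contained in `Ω`. -/
def IsTestFunction {N : ℕ} (Ω : Set (EuclideanSpace ℝ (Fin N)))
    (φ : EuclideanSpace ℝ (Fin N) → ℝ) : Prop :=
  ContDiff ℝ ((⊤ : ℕ∞) : WithTop ℕ∞) φ ∧ HasCompactSupport φ ∧ tsupport φ ⊆ Ω

/-- `u` belongs to the Sobolev space `H_0^1(Ω)`, the closure of the test functions in `H^1(Ω)`,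
and `g` is its weak gradient: some sequence of test functions converges to `u` in `L²(Ω)` while
the gradients converge to `g` in `L²(Ω)`. -/
def IsSobolevH10 {N : ℕ} (Ω : Set (EuclideanSpace ℝ (Fin N)))
    (u : EuclideanSpace ℝ (Fin N) → ℝ)
    (g : EuclideanSpace ℝ (Fin N) → EuclideanSpace ℝ (Fin N)) : Prop :=
  MemLp u 2 (volume.restrict Ω) ∧ MemLp g 2 (volume.restrict Ω) ∧
    ∃ φ : ℕ → EuclideanSpace ℝ (Fin N) → ℝ, (∀ n, IsTestFunction Ω (φ n)) ∧
      Tendsto (fun n => eLpNorm (fun x => φ n x - u x) 2 (volume.restrict Ω)) atTop (𝓝 0) ∧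
      Tendsto (fun n => eLpNorm (fun x => gradient (φ n) x - g x) 2 (volume.restrict Ω))
        atTop (𝓝 0)

/-- `ev` is an eigenvalue of `-Δ` in `H_0^1(Ω)`: there is `u ≠ 0` in `H_0^1(Ω)` with
`∫ ∇u · ∇v = ev ∫ u v` for all `v` in `H_0^1(Ω)`. -/
def IsDirichletEigenvalue {N : ℕ} (Ω : Set (EuclideanSpace ℝ (Fin N))) (ev : ℝ) : Prop :=
  ∃ (u : EuclideanSpace ℝ (Fin N) → ℝ)
    (g : EuclideanSpace ℝ (Fin N) → EuclideanSpace ℝ (Fin N)),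
    IsSobolevH10 Ω u g ∧ ¬ (u =ᵐ[volume.restrict Ω] 0) ∧
      ∀ (v : EuclideanSpace ℝ (Fin N) → ℝ)
        (w : EuclideanSpace ℝ (Fin N) → EuclideanSpace ℝ (Fin N)), IsSobolevH10 Ω v w →
        ∫ x in Ω, inner ℝ (g x) (w x) = ev * ∫ x in Ω, u x * v x

/-- The first (smallest) eigenvalue of `-Δ` in `H_0^1` of the open unit ball of `ℝ^N`. -/
def firstDirichletEigenvalue (N : ℕ) : ℝ :=
  sInf {ev : ℝ | IsDirichletEigenvalue (ball (0 : EuclideanSpace ℝ (Fin N)) 1) ev}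

/-- The infimum of `|ω k - ω n|` over distinct indices `k`, `n` in `S`, with values in `[0, ∞]`
(it is `∞` if `S` has at most one element). -/
def familyGap {N : ℕ} {K : Type*} (ω : K → EuclideanSpace ℝ (Fin N)) (S : Set K) : ℝ≥0∞ :=
  ⨅ (k ∈ S) (n ∈ S) (_ : k ≠ n), ENNReal.ofReal ‖ω k - ω n‖

/-- The radius `2 √μ / g`, where `μ` is the first Dirichlet eigenvalue of the unit ball;
it is `0` for `g = ∞`. -/
def criticalRadius (N : ℕ) (g : ℝ≥0∞) : ℝ :=
  (ENNReal.ofReal (2 * Real.sqrt (firstDirichletEigenvalue N)) / g).toReal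

/-- The function `f` is the sum of the series `∑ x_k e^{i ω_k · t}` in `L²(Ω)`, as the limit of
the net of all finite partial sums. -/
def IsExpSumInL2 {N : ℕ} {K : Type*} (Ω : Set (EuclideanSpace ℝ (Fin N)))
    (ω : K → EuclideanSpace ℝ (Fin N)) (x : K → ℂ)
    (f : EuclideanSpace ℝ (Fin N) → ℂ) : Prop :=
  MemLp f 2 (volume.restrict Ω) ∧
    Tendsto (fun s : Finset K =>
      eLpNorm (fun t => (∑ k ∈ s, x k * Complex.exp (Complex.I * ((inner ℝ (ω k) t : ℝ) : ℂ)))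
        - f t) 2 (volume.restrict Ω)) atTop (𝓝 0)

end

/-! The exponential sums are first bounded for finitely many frequencies; the bounds then pass to
square summable families by completeness of `L²`.

*One family.* Let `h` be supported in the ball of radius `g / (4π)`. If the frequencies are
`g`-separated, then `𝓕 h` times an exponential sum `f` is the Fourier transform of a sum of
translates of `h` with disjoint supports, so `∫ |𝓕 h|² |f|² = ∑ |x_k|² ∫ |h|²` by Plancherel
(`integral_norm_fourier_mul_expSum_sq`). A narrow bump `h` gives the upper bound
(`exists_integral_ball_expSum_le`). For the lower bound, apply the identity to `h` and to its
partial derivatives: `∫ (r² - |t|²) |𝓕 h|² |f|²` equals `∑ |x_k|²` times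
`r² ∫ |h|² - (4π²)⁻¹ ∫ |∇h|²`, which is positive for `r > 2 √μ / g` if `h` is a dilated test
function whose Rayleigh quotient is close to `μ`, and the weight is nonpositive outside the ball of
radius `r` (`sum_norm_sq_le_integral_ball_expSum`). Of `μ` one only
needs that it is at least the infimum of the Rayleigh quotients, which does not require the
existence of a minimizer (`exists_isTestFunction_rayleigh_le`).

*Several families.* The estimate is first proved for one coefficient `x_k` at a time. For a family
not containing `k`, the coefficients over the family together with `k` are controlled on a ball
slightly larger than the critical one: the differences `f(t) - e^{-i ω_k · y} f(t + y)` have no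
frequency `ω_k`, and averaging over `y` costs two powers of the excess `δ` of the radius besides the
one lost by the family itself (`sum_norm_sq_le_of_insert`). This bound makes the Gram matrix of the
exponentials invertible and so provides a biorthogonal function on that ball
(`exists_biorthogonal`); convolving with it removes the whole family, preserves `x_k`, and adds the
radii (`norm_sq_le_of_union`). A family with infinite gap is a single frequency and is removed by
one difference (`norm_sq_le_of_insert`). Starting from the family of `k`, which costs at most
`δ ^ N`, one obtains a bound for each `|x_k|²` on the ball of radius `R₀ + m δ`, with a constant of
order `δ ^ (N + 3 (m - 1))` (`exists_coefficient_bound_partition`).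

*From coefficients to `ℓ²`.* Applying the coefficient bounds to averages of `f e^{-i ω_k · y}` over
a ball of radius `δ` and summing over `k` by the dual of the upper bound costs another `δ ^ N`
(`sum_norm_sq_le_of_forall_norm_sq_le`). The total power `2 N + 3 (m - 1)` is at most
`5 m - 4 + 2 N`, and `R - R₀` is bounded by `R₀`. -/

/-! ### Exponential sums and integrals over balls -/

section Basics

variable {E : Type*} [NormedAddCommGroup E] [InnerProductSpace ℝ E]

/-- The plane wave `t ↦ e^{i w · t}` of frequency `w`. -/
noncomputable def wave (w t : E) : ℂ := Complex.exp (Complex.I * ((inner ℝ w t : ℝ) : ℂ))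

lemma wave_add_right (w t y : E) : wave w (t + y) = wave w t * wave w y := by
  simp [wave, inner_add_right, mul_add, Complex.exp_add]

lemma wave_add_left (w v t : E) : wave (w + v) t = wave w t * wave v t := by
  simp [wave, inner_add_left, mul_add, Complex.exp_add]

@[simp] lemma wave_zero_left (t : E) : wave 0 t = 1 := by simp [wave]

@[simp] lemma norm_wave (w t : E) : ‖wave w t‖ = 1 := by
  rw [wave, mul_comm]; exact Complex.norm_exp_ofReal_mul_I _

lemma wave_neg_left (w t : E) : wave (-w) t = starRingEnd ℂ (wave w t) := by
  simp [wave, ← Complex.exp_conj]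

lemma wave_sub_left (w v t : E) : wave (w - v) t = wave w t * wave (-v) t := by
  rw [sub_eq_add_neg, wave_add_left]

lemma wave_mul_wave_neg (w t : E) : wave w t * wave (-w) t = 1 := by
  rw [← wave_add_left]; simp

@[fun_prop] lemma continuous_wave (w : E) : Continuous (wave w) := by
  unfold wave; fun_prop

lemma norm_sub_wave_sq (w t : E) : ‖1 - wave w t‖ ^ 2 = 2 * (1 - Real.cos (inner ℝ w t)) := by
  rw [wave, ← Complex.normSq_eq_norm_sq, Complex.normSq_apply]
  simp [Complex.exp_re, Complex.exp_im]
  nlinarith [Real.sin_sq_add_cos_sq (inner ℝ w t)]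

/-- The finite exponential sum `∑_{k ∈ s} x_k e^{i ω_k · t}`. -/
noncomputable def expSum {K : Type*} (ω : K → E) (s : Finset K) (x : K → ℂ) (t : E) : ℂ :=
  ∑ k ∈ s, x k * wave (ω k) t

@[fun_prop] lemma continuous_expSum {K : Type*} (ω : K → E) (s : Finset K) (x : K → ℂ) :
    Continuous (expSum ω s x) := by
  unfold expSum; fun_prop

lemma expSum_add_right {K : Type*} (ω : K → E) (s : Finset K) (x : K → ℂ) (t y : E) :
    expSum ω s x (t + y) = expSum ω s (fun k => x k * wave (ω k) y) t := by
  unfold expSum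
  exact Finset.sum_congr rfl fun k _ => by rw [wave_add_right]; ring

variable [FiniteDimensional ℝ E] [MeasurableSpace E] [BorelSpace E]

lemma Continuous.integrableOn_ball_zero {F : Type*} [NormedAddCommGroup F] {f : E → F}
    (hf : Continuous f) (r : ℝ) : IntegrableOn f (ball 0 r) :=
  (hf.continuousOn.integrableOn_compact (isCompact_closedBall 0 r)).mono_set ball_subset_closedBall

lemma integral_ball_mono_radius {f : E → ℂ} (hf : Continuous f) {r r' : ℝ} (h : r ≤ r') :
    ∫ t in ball (0 : E) r, ‖f t‖ ^ 2 ≤ ∫ t in ball (0 : E) r', ‖f t‖ ^ 2 :=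
  setIntegral_mono_set ((hf.norm.pow 2).integrableOn_ball_zero r')
    (Eventually.of_forall fun _ => by positivity) (ball_subset_ball h).eventuallyLE

lemma integral_ball_shift_le {f : E → ℂ} (hf : Continuous f) (r : ℝ) (y : E) :
    ∫ t in ball (0 : E) r, ‖f (t + y)‖ ^ 2 ≤ ∫ t in ball (0 : E) (r + ‖y‖), ‖f t‖ ^ 2 := by
  have h : ∫ t in ball (0 : E) r, ‖f (t + y)‖ ^ 2 = ∫ t in ball y r, ‖f t‖ ^ 2 := by
    have := (measurePreserving_add_right (volume : Measure E) y).setIntegral_preimage_emb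
      (measurableEmbedding_addRight y) (fun t => ‖f t‖ ^ 2) (ball y r)
    rw [← this]
    congr 2
    ext t
    simp [dist_eq_norm]
  rw [h]
  refine setIntegral_mono_set ((hf.norm.pow 2).integrableOn_ball_zero _)
    (Eventually.of_forall fun _ => by positivity) (LE.le.eventuallyLE ?_)
  exact ball_subset_ball' (by simp)

lemma Continuous.integrable_prod_ball {F : Type*} [NormedAddCommGroup F] {f : E × E → F}
    (hf : Continuous f) (r ρ : ℝ) :
    Integrable f (((volume : Measure E).restrict (ball 0 r)).prod
      ((volume : Measure E).restrict (ball 0 ρ))) := by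
  rw [Measure.prod_restrict]
  exact (hf.continuousOn.integrableOn_compact ((isCompact_closedBall (0 : E) r).prod
    (isCompact_closedBall (0 : E) ρ))).mono_set
    (Set.prod_mono ball_subset_closedBall ball_subset_closedBall)

lemma integral_ball_integral_ball_le {f : E → ℂ} (hf : Continuous f) {r ρ : ℝ} :
    ∫ t in ball (0 : E) r, ∫ y in ball (0 : E) ρ, ‖f (t + y)‖ ^ 2
      ≤ volume.real (ball (0 : E) ρ) * ∫ t in ball (0 : E) (r + ρ), ‖f t‖ ^ 2 := by
  have hi := Continuous.integrable_prod_ball (f := fun p : E × E => ‖f (p.1 + p.2)‖ ^ 2)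
    (by fun_prop) r ρ
  rw [integral_integral_swap hi]
  calc ∫ y in ball (0 : E) ρ, ∫ t in ball (0 : E) r, ‖f (t + y)‖ ^ 2
      ≤ ∫ y in ball (0 : E) ρ, ∫ t in ball (0 : E) (r + ρ), ‖f t‖ ^ 2 := by
        refine setIntegral_mono_on hi.integral_prod_right
          (integrableOn_const (by exact measure_ball_lt_top.ne)) measurableSet_ball fun y hy => ?_
        refine (integral_ball_shift_le hf r y).trans (integral_ball_mono_radius hf ?_)
        have := mem_ball_zero_iff.1 hy
        linarith
    _ = _ := by simp [Measure.real]

lemma norm_integral_ball_mul_sq_le {f g : E → ℂ} (hf : Continuous f) (hg : Continuous g) (r : ℝ) :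
    ‖∫ t in ball (0 : E) r, f t * g t‖ ^ 2
      ≤ (∫ t in ball (0 : E) r, ‖f t‖ ^ 2) * ∫ t in ball (0 : E) r, ‖g t‖ ^ 2 := by
  have h2 : ∀ {h : E → ℂ}, Continuous h →
      MemLp h (ENNReal.ofReal 2) (volume.restrict (ball (0 : E) r)) := by
    intro h hh
    rw [show ENNReal.ofReal 2 = 2 by norm_num]
    exact (memLp_two_iff_integrable_sq_norm hh.aestronglyMeasurable).2
      ((hh.norm.pow 2).integrableOn_ball_zero r)
  have h := integral_mul_norm_le_Lp_mul_Lq Real.HolderConjugate.two_two (h2 hf) (h2 hg)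
  have h0 : ‖∫ t in ball (0 : E) r, f t * g t‖ ≤ ∫ t in ball (0 : E) r, ‖f t‖ * ‖g t‖ := by
    refine (norm_integral_le_integral_norm _).trans (le_of_eq ?_)
    simp
  have hA : 0 ≤ ∫ t in ball (0 : E) r, ‖f t‖ ^ 2 := integral_nonneg fun _ => by positivity
  have hB : 0 ≤ ∫ t in ball (0 : E) r, ‖g t‖ ^ 2 := integral_nonneg fun _ => by positivity
  simp only [Real.rpow_two, ← Real.sqrt_eq_rpow] at h
  calc _ ≤ (√(∫ t in ball (0 : E) r, ‖f t‖ ^ 2) * √(∫ t in ball (0 : E) r, ‖g t‖ ^ 2)) ^ 2 :=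
        pow_le_pow_left₀ (norm_nonneg _) (h0.trans h) 2
    _ = _ := by rw [mul_pow, Real.sq_sqrt hA, Real.sq_sqrt hB]

end Basics

/-! ### Plancherel's theorem for well separated translates -/

section Plancherel

open scoped FourierTransform SchwartzMap LineDeriv

variable {E : Type*} [NormedAddCommGroup E] [InnerProductSpace ℝ E] [FiniteDimensional ℝ E]
  [MeasurableSpace E] [BorelSpace E]

lemma norm_sum_sq_of_disjoint {K : Type*} (s : Finset K) (c : K → ℂ)
    (h : ∀ k ∈ s, ∀ n ∈ s, k ≠ n → c k = 0 ∨ c n = 0) :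
    ‖∑ k ∈ s, c k‖ ^ 2 = ∑ k ∈ s, ‖c k‖ ^ 2 := by
  by_cases hk : ∃ k ∈ s, c k ≠ 0
  · obtain ⟨k, hks, hk⟩ := hk
    have h0 : ∀ n ∈ s, n ≠ k → c n = 0 := fun n hn hnk => (h n hn k hks hnk).resolve_right hk
    rw [Finset.sum_eq_single_of_mem k hks h0, Finset.sum_eq_single_of_mem k hks
      fun n hn hnk => by simp [h0 n hn hnk]]
  · push Not at hk
    rw [Finset.sum_eq_zero hk, Finset.sum_eq_zero fun k hks => by simp [hk k hks]]
    simp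

lemma SchwartzMap.fourier_compSubConst (h : 𝓢(E, ℂ)) (a t : E) :
    𝓕 (h.compSubConstCLM ℂ a) t = wave (-(2 * Real.pi) • a) t * 𝓕 h t := by
  rw [SchwartzMap.fourier_coe, SchwartzMap.fourier_coe, Real.fourier_eq', Real.fourier_eq',
    ← integral_const_mul,
    ← integral_add_right_eq_self _ a]
  refine integral_congr_ae (Eventually.of_forall fun v => ?_)
  simp only [SchwartzMap.compSubConstCLM_apply, smul_eq_mul, wave, ← mul_assoc, ← Complex.exp_add]
  rw [add_sub_cancel_right, inner_add_left, inner_smul_left]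
  congr 2
  push_cast
  simp
  ring

lemma SchwartzMap.integrable_norm_sq (h : 𝓢(E, ℂ)) : Integrable fun x => ‖h x‖ ^ 2 :=
  (memLp_two_iff_integrable_sq_norm h.continuous.aestronglyMeasurable).1 (h.memLp 2 volume)

/-- If the frequencies `ω k` are `g`-separated and `h` vanishes outside the ball of radius
`g / (4π)`, then multiplying an exponential sum by `𝓕 h` gives the Fourier transform of a sum of
translates of `h` with disjoint supports, whence Plancherel's theorem yields an exact identity. -/
lemma integral_norm_fourier_mul_expSum_sq {K : Type*} (h : 𝓢(E, ℂ)) {g : ℝ}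
    (hsupp : ∀ x, g / (4 * Real.pi) ≤ ‖x‖ → h x = 0) (ω : K → E) (s : Finset K)
    (hgap : ∀ k ∈ s, ∀ n ∈ s, k ≠ n → g ≤ ‖ω k - ω n‖) (x : K → ℂ) :
    Integrable (fun t => ‖𝓕 h t‖ ^ 2 * ‖expSum ω s x t‖ ^ 2) ∧
    ∫ t, ‖𝓕 h t‖ ^ 2 * ‖expSum ω s x t‖ ^ 2 = (∑ k ∈ s, ‖x k‖ ^ 2) * ∫ t, ‖h t‖ ^ 2 := by
  set a : K → E := fun k => -(2 * Real.pi)⁻¹ • ω k with ha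
  set u : 𝓢(E, ℂ) := ∑ k ∈ s, x k • h.compSubConstCLM ℂ (a k) with hu
  have hpi := Real.pi_pos
  have h1 : ∀ t, ‖𝓕 h t‖ ^ 2 * ‖expSum ω s x t‖ ^ 2 = ‖𝓕 u t‖ ^ 2 := by
    intro t
    have : 𝓕 u t = 𝓕 h t * expSum ω s x t := by
      have hlin : 𝓕 u = ∑ k ∈ s, x k • 𝓕 (h.compSubConstCLM ℂ (a k)) := by
        simp only [hu, ← SchwartzMap.fourierTransformCLM_apply (𝕜 := ℂ), map_sum, map_smul]
      rw [hlin, expSum, Finset.mul_sum]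
      simp only [sum_apply, smul_apply, SchwartzMap.fourier_compSubConst,
        smul_eq_mul]
      refine Finset.sum_congr rfl fun k _ => ?_
      have : -(2 * Real.pi) • a k = ω k := by
        simp only [ha, smul_smul]
        field_simp
        simp
      rw [this]
      ring
    rw [this, norm_mul, mul_pow]
  have h2 : ∀ y, ‖u y‖ ^ 2 = ∑ k ∈ s, ‖x k‖ ^ 2 * ‖h (y - a k)‖ ^ 2 := by
    intro y
    simp only [hu, sum_apply, smul_apply,
      SchwartzMap.compSubConstCLM_apply, smul_eq_mul]
    rw [norm_sum_sq_of_disjoint]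
    · simp [mul_pow]
    · intro k hk n hn hkn
      by_contra! hc
      have hk' : ‖y - a k‖ < g / (4 * Real.pi) := by
        by_contra! hh
        exact hc.1 (by simp [hsupp _ hh])
      have hn' : ‖y - a n‖ < g / (4 * Real.pi) := by
        by_contra! hh
        exact hc.2 (by simp [hsupp _ hh])
      have h3 : (2 * Real.pi) • ((y - a k) - (y - a n)) = ω k - ω n := by
        simp only [ha]
        rw [sub_sub_sub_cancel_left, ← smul_sub, smul_smul]
        rw [mul_neg, mul_inv_cancel₀ (by positivity)]
        simp
      have h4 := hgap k hk n hn hkn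
      rw [← h3, norm_smul, Real.norm_of_nonneg (by positivity)] at h4
      have h5 := norm_sub_le (y - a k) (y - a n)
      have h6 : ‖y - a k - (y - a n)‖ < 2 * (g / (4 * Real.pi)) := by linarith
      have h7 := mul_lt_mul_of_pos_left h6 (show 0 < 2 * Real.pi by positivity)
      have h8 : 2 * Real.pi * (2 * (g / (4 * Real.pi))) = g := by field_simp; ring
      linarith
  simp_rw [h1]
  refine ⟨(𝓕 u).integrable_norm_sq, ?_⟩
  rw [SchwartzMap.integral_norm_sq_fourier]
  simp_rw [h2]
  rw [integral_finsetSum, Finset.sum_mul]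
  · refine Finset.sum_congr rfl fun k _ => ?_
    rw [integral_const_mul, integral_sub_right_eq_self (fun y => ‖h y‖ ^ 2) (a k)]
  · exact fun k _ => (h.integrable_norm_sq.comp_sub_right (a k)).const_mul _

lemma SchwartzMap.norm_fourier_sq_mul_norm_sq {ι : Type*} [Fintype ι] (b : OrthonormalBasis ι ℝ E)
    (h : 𝓢(E, ℂ)) (t : E) :
    (4 * Real.pi ^ 2) * (‖t‖ ^ 2 * ‖𝓕 h t‖ ^ 2) = ∑ i, ‖𝓕 (∂_{b i} h) t‖ ^ 2 := by
  have : ∀ i, ‖𝓕 (∂_{b i} h) t‖ ^ 2 = (4 * Real.pi ^ 2) * ‖𝓕 h t‖ ^ 2 * ‖inner ℝ t (b i)‖ ^ 2 := by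
    intro i
    have hg : (fun y : E => inner ℝ y (b i)).HasTemperateGrowth :=
      ((innerSL ℝ).flip (b i)).hasTemperateGrowth
    rw [SchwartzMap.fourier_lineDerivOp_eq, smul_apply,
      SchwartzMap.smulLeftCLM_apply_apply hg]
    simp only [norm_smul, mul_pow, norm_mul, Complex.norm_real, Complex.norm_I, Complex.norm_ofNat,
      Real.norm_eq_abs, sq_abs]
    ring
  rw [Finset.sum_congr rfl fun i _ => this i, ← Finset.mul_sum, b.sum_sq_norm_inner_left]
  ring

/-- The direct inequality: on every ball, the exponentials of a separated family form a Bessel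
sequence. The weight is `|𝓕 h|²` for a bump `h ≥ 0` whose support is so small that
`|𝓕 h| ≥ (∫ h) / 2` on the ball. -/
lemma exists_integral_ball_expSum_le {g : ℝ} (hg : 0 < g) (r : ℝ) :
    ∃ C : ℝ, 0 < C ∧ ∀ {K : Type*} (ω : K → E) (s : Finset K),
      (∀ k ∈ s, ∀ n ∈ s, k ≠ n → g ≤ ‖ω k - ω n‖) → ∀ x : K → ℂ,
        ∫ t in ball (0 : E) r, ‖expSum ω s x t‖ ^ 2 ≤ C * ∑ k ∈ s, ‖x k‖ ^ 2 := by
  have hpi := Real.pi_pos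
  obtain ⟨ρ, hρ, hρg, hρr⟩ : ∃ ρ : ℝ, 0 < ρ ∧ ρ ≤ g / (4 * Real.pi) ∧
      2 * Real.pi * (ρ * |r|) ≤ 1 / 2 := by
    refine ⟨min (g / (4 * Real.pi)) (1 / (4 * Real.pi * (|r| + 1))), by positivity,
      min_le_left _ _, ?_⟩
    have h1 : min (g / (4 * Real.pi)) (1 / (4 * Real.pi * (|r| + 1))) * |r|
        ≤ 1 / (4 * Real.pi * (|r| + 1)) * (|r| + 1) := by
      have := abs_nonneg r
      gcongr
      · exact min_le_right _ _
      · linarith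
    have h2 : 2 * Real.pi * (1 / (4 * Real.pi * (|r| + 1)) * (|r| + 1)) = 1 / 2 := by
      have := abs_nonneg r
      field_simp; norm_num
    calc _ ≤ _ := mul_le_mul_of_nonneg_left h1 (by positivity)
      _ = _ := h2
  let φ : ContDiffBump (0 : E) := ⟨ρ / 2, ρ, by positivity, by linarith⟩
  have hc : HasCompactSupport (fun x => ((φ x : ℝ) : ℂ)) :=
    φ.hasCompactSupport.comp_left Complex.ofReal_zero
  have hd : ContDiff ℝ ((⊤ : ℕ∞) : WithTop ℕ∞) (fun x => ((φ x : ℝ) : ℂ)) :=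
    Complex.ofRealCLM.contDiff.comp φ.contDiff
  set h : 𝓢(E, ℂ) := hc.toSchwartzMap hd with hh
  have hval : ∀ x, h x = ((φ x : ℝ) : ℂ) := fun x => rfl
  set I : ℝ := ∫ x, φ x with hI
  have hIpos : 0 < I := φ.integral_pos
  have hsuppρ : ∀ x, ρ ≤ ‖x‖ → φ x = 0 := fun x hx => φ.zero_of_le_dist (by simpa using hx)
  have hsupp : ∀ x, g / (4 * Real.pi) ≤ ‖x‖ → h x = 0 := fun x hx => by
    rw [hval, hsuppρ x (hρg.trans hx)]; simp
  have hlow : ∀ t ∈ ball (0 : E) r, I / 2 ≤ ‖𝓕 h t‖ := by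
    intro t ht
    have ht' : ‖t‖ ≤ |r| := (mem_ball_zero_iff.1 ht).le.trans (le_abs_self r)
    have hi1 : Integrable
        (fun v => Complex.exp (↑(-2 * Real.pi * inner ℝ v t) * Complex.I) • h v) := by
      refine h.integrable.bdd_mul (c := 1) (by fun_prop) ?_
      exact Eventually.of_forall fun v => by rw [Complex.norm_exp_ofReal_mul_I]
    have key : ‖𝓕 h t - (I : ℂ)‖ ≤ I / 2 := by
      rw [SchwartzMap.fourier_coe, Real.fourier_eq', hI, ← integral_complex_ofReal,
        show (fun v => ((φ v : ℝ) : ℂ)) = h from rfl, ← integral_sub hi1 h.integrable]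
      calc _ ≤ ∫ x, 1 / 2 * φ x := by
            refine norm_integral_le_of_norm_le (φ.integrable.const_mul _)
              (Eventually.of_forall fun v => ?_)
            rw [hval, smul_eq_mul, ← sub_one_mul, norm_mul, Complex.norm_real,
              Real.norm_of_nonneg φ.nonneg]
            by_cases hv : ρ ≤ ‖v‖
            · simp [hsuppρ v hv]
            · refine mul_le_mul_of_nonneg_right ?_ φ.nonneg
              rw [mul_comm]
              refine Real.norm_exp_I_mul_ofReal_sub_one_le.trans (le_trans ?_ hρr)
              rw [norm_mul, norm_mul, norm_neg]
              rw [Real.norm_of_nonneg hpi.le, Real.norm_ofNat]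
              gcongr
              refine (norm_inner_le_norm v t).trans ?_
              push Not at hv
              gcongr
        _ = I / 2 := by rw [integral_const_mul]; ring
    have h3 := norm_sub_norm_le (I : ℂ) (𝓕 h t)
    rw [norm_sub_rev, Complex.norm_real, Real.norm_of_nonneg hIpos.le] at h3
    linarith
  refine ⟨((∫ t, ‖h t‖ ^ 2) + 1) / (I / 2) ^ 2, ?_, ?_⟩
  · have : 0 ≤ ∫ t, ‖h t‖ ^ 2 := integral_nonneg fun _ => by positivity
    positivity
  intro K ω s hgap x
  obtain ⟨hint, heq⟩ := integral_norm_fourier_mul_expSum_sq h hsupp ω s hgap x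
  have h4 : (I / 2) ^ 2 * ∫ t in ball (0 : E) r, ‖expSum ω s x t‖ ^ 2
      ≤ (∑ k ∈ s, ‖x k‖ ^ 2) * ∫ t, ‖h t‖ ^ 2 := by
    rw [← heq, ← integral_const_mul]
    refine le_trans ?_ (setIntegral_le_integral (s := ball (0 : E) r) hint
      (Eventually.of_forall fun _ => by positivity))
    refine setIntegral_mono_on
      (((continuous_expSum ω s x).norm.pow 2).const_mul _ |>.integrableOn_ball_zero r)
      hint.integrableOn measurableSet_ball fun t ht => ?_
    have := hlow t ht
    gcongr
  have h5 : 0 ≤ ∑ k ∈ s, ‖x k‖ ^ 2 := Finset.sum_nonneg fun _ _ => by positivity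
  rw [div_mul_eq_mul_div, le_div_iff₀ (by positivity)]
  linarith

end Plancherel

/-! ### The first Dirichlet eigenvalue as a Rayleigh quotient -/

section Rayleigh

variable {N : ℕ}

lemma integral_norm_sq_eq_toReal_eLpNorm {α F : Type*} [MeasurableSpace α] [NormedAddCommGroup F]
    {μ : Measure α} {f : α → F} (hf : MemLp f 2 μ) :
    ∫ x, ‖f x‖ ^ 2 ∂μ = (eLpNorm f 2 μ).toReal ^ 2 := by
  have h := hf.eLpNorm_eq_integral_rpow_norm (by norm_num) (by norm_num)
  have h0 : 0 ≤ ∫ x, ‖f x‖ ^ 2 ∂μ := integral_nonneg fun _ => by positivity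
  simp only [ENNReal.toReal_ofNat, Real.rpow_two] at h
  rw [h, ENNReal.toReal_ofReal (by positivity), ← Real.rpow_two, ← Real.rpow_mul h0]
  norm_num

lemma tendsto_integral_norm_sq_of_eLpNorm_sub {α F ι : Type*} [MeasurableSpace α]
    [NormedAddCommGroup F] {μ : Measure α} {l : Filter ι} {u : ι → α → F} {f : α → F}
    (hu : ∀ i, MemLp (u i) 2 μ)
    (hf : MemLp f 2 μ) (h : Tendsto (fun i => eLpNorm (fun x => u i x - f x) 2 μ) l (𝓝 0)) :
    Tendsto (fun i => ∫ x, ‖u i x‖ ^ 2 ∂μ) l (𝓝 (∫ x, ‖f x‖ ^ 2 ∂μ)) := by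
  simp_rw [fun i => integral_norm_sq_eq_toReal_eLpNorm (hu i),
    integral_norm_sq_eq_toReal_eLpNorm hf]
  refine Tendsto.pow ?_ 2
  rw [tendsto_iff_dist_tendsto_zero]
  have h' : Tendsto (fun i => (eLpNorm (fun x => u i x - f x) 2 μ).toReal) l (𝓝 0) := by
    exact (ENNReal.tendsto_toReal ENNReal.zero_ne_top).comp h
  refine squeeze_zero (fun _ => dist_nonneg) (fun i => ?_) h'
  have e1 : (eLpNorm (u i) 2 μ).toReal = ‖(hu i).toLp‖ := (Lp.norm_toLp _ _).symm
  have e2 : (eLpNorm f 2 μ).toReal = ‖hf.toLp‖ := (Lp.norm_toLp _ _).symm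
  have e3 : (eLpNorm (fun x => u i x - f x) 2 μ).toReal = ‖(hu i).toLp - hf.toLp‖ := by
    rw [← MemLp.toLp_sub, Lp.norm_toLp]; rfl
  rw [e1, e2, e3, Real.dist_eq]
  exact abs_norm_sub_norm_le _ _

lemma IsTestFunction.continuous_gradient {Ω : Set (EuclideanSpace ℝ (Fin N))}
    {φ : EuclideanSpace ℝ (Fin N) → ℝ} (h : IsTestFunction Ω φ) : Continuous (gradient φ) := by
  unfold gradient
  exact (LinearIsometryEquiv.continuous _).comp (h.1.continuous_fderiv (by simp))

lemma IsTestFunction.gradient_eq_zero {Ω : Set (EuclideanSpace ℝ (Fin N))}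
    {φ : EuclideanSpace ℝ (Fin N) → ℝ} (h : IsTestFunction Ω φ) {x : EuclideanSpace ℝ (Fin N)}
    (hx : x ∉ Ω) : gradient φ x = 0 := by
  rw [gradient, show fderiv ℝ φ x = 0 from ?_]
  · simp
  · have : x ∉ tsupport (fderiv ℝ φ) := fun hh => hx (h.2.2 (tsupport_fderiv_subset ℝ hh))
    exact image_eq_zero_of_notMem_tsupport this

/-- An upper bound for the infimum of the Rayleigh quotient over test functions. An eigenfunction
tested against itself has the eigenvalue as its Rayleigh quotient, and test functions approximate
it. Positivity of `firstDirichletEigenvalue N` excludes the junk value of `sInf ∅`. -/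
lemma exists_isTestFunction_rayleigh_le (hμ : 0 < firstDirichletEigenvalue N) {q : ℝ}
    (hq : firstDirichletEigenvalue N < q) :
    ∃ φ : EuclideanSpace ℝ (Fin N) → ℝ, IsTestFunction (ball 0 1) φ ∧ 0 < ∫ x, φ x ^ 2 ∧
      ∫ x, ‖gradient φ x‖ ^ 2 ≤ q * ∫ x, φ x ^ 2 := by
  have hne : {ev : ℝ |
      IsDirichletEigenvalue (ball (0 : EuclideanSpace ℝ (Fin N)) 1) ev}.Nonempty := by
    by_contra h
    rw [Set.not_nonempty_iff_eq_empty] at h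
    rw [firstDirichletEigenvalue, h, Real.sInf_empty] at hμ
    exact lt_irrefl _ hμ
  obtain ⟨ev, ⟨u, g, hug, hu0, heq⟩, hev⟩ := exists_lt_of_csInf_lt hne hq
  obtain ⟨hu, hg, φ, hφ, hφu, hφg⟩ := hug
  have hmem : ∀ {F : Type} [NormedAddCommGroup F] {v : EuclideanSpace ℝ (Fin N) → F},
      Continuous v → MemLp v 2 (volume.restrict (ball (0 : EuclideanSpace ℝ (Fin N)) 1)) :=
    fun hv => (memLp_two_iff_integrable_sq_norm hv.aestronglyMeasurable).2
      ((hv.norm.pow 2).integrableOn_ball_zero 1)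
  have t1 := tendsto_integral_norm_sq_of_eLpNorm_sub (fun n => hmem (hφ n).1.continuous) hu hφu
  have t2 := tendsto_integral_norm_sq_of_eLpNorm_sub
    (fun n => hmem (hφ n).continuous_gradient) hg hφg
  have hself := heq u g ⟨hu, hg, φ, hφ, hφu, hφg⟩
  simp only [real_inner_self_eq_norm_sq, ← pow_two] at hself
  simp only [Real.norm_eq_abs, sq_abs] at t1
  have hpos : 0 < ∫ x in ball (0 : EuclideanSpace ℝ (Fin N)) 1, u x ^ 2 := by
    refine lt_of_le_of_ne (integral_nonneg fun _ => by positivity) fun h => hu0 ?_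
    have hi : Integrable (fun x => u x ^ 2)
        (volume.restrict (ball (0 : EuclideanSpace ℝ (Fin N)) 1)) := hu.integrable_sq
    have := (integral_eq_zero_iff_of_nonneg (fun _ => by positivity) hi).1 h.symm
    filter_upwards [this] with x hx
    simpa using hx
  have hlt : ev * ∫ x in ball (0 : EuclideanSpace ℝ (Fin N)) 1, u x ^ 2
      < q * ∫ x in ball (0 : EuclideanSpace ℝ (Fin N)) 1, u x ^ 2 :=
    mul_lt_mul_of_pos_right hev hpos
  rw [← hself] at hlt
  obtain ⟨n, hn1, hn2⟩ := ((t2.eventually_lt (t1.const_mul q) hlt).and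
    (t1.eventually (lt_mem_nhds hpos))).exists
  have e1 : ∫ x in ball (0 : EuclideanSpace ℝ (Fin N)) 1, φ n x ^ 2 = ∫ x, φ n x ^ 2 :=
    setIntegral_eq_integral_of_forall_compl_eq_zero fun x hx => by
      rw [image_eq_zero_of_notMem_tsupport fun h => hx ((hφ n).2.2 h)]; simp
  have e2 : ∫ x in ball (0 : EuclideanSpace ℝ (Fin N)) 1, ‖gradient (φ n) x‖ ^ 2
      = ∫ x, ‖gradient (φ n) x‖ ^ 2 :=
    setIntegral_eq_integral_of_forall_compl_eq_zero fun x hx => by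
      rw [(hφ n).gradient_eq_zero hx]; simp
  rw [e1] at hn1 hn2
  rw [e2] at hn1
  exact ⟨φ n, hφ n, hn2, hn1.le⟩

end Rayleigh

/-! ### Lower bound for one separated family -/

section SingleFamily

open scoped FourierTransform SchwartzMap LineDeriv

variable {N : ℕ}

lemma SchwartzMap.norm_fourier_sq_le_of_support {E : Type*} [NormedAddCommGroup E]
    [InnerProductSpace ℝ E] [FiniteDimensional ℝ E] [MeasurableSpace E] [BorelSpace E]
    (h : 𝓢(E, ℂ)) {σ : ℝ} (hsupp : ∀ x, σ ≤ ‖x‖ → h x = 0) (t : E) :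
    ‖𝓕 h t‖ ^ 2 ≤ volume.real (ball (0 : E) σ) * ∫ x, ‖h x‖ ^ 2 := by
  have hz : ∀ x ∉ ball (0 : E) σ, h x = 0 := fun x hx => hsupp x (by simpa using hx)
  have e1 : 𝓕 h t = ∫ v in ball (0 : E) σ,
      Complex.exp (↑(-2 * Real.pi * inner ℝ v t) * Complex.I) * h v := by
    rw [SchwartzMap.fourier_coe, Real.fourier_eq']
    exact (setIntegral_eq_integral_of_forall_compl_eq_zero fun x hx => by simp [hz x hx]).symm
  have e2 : ∫ v in ball (0 : E) σ, ‖h v‖ ^ 2 = ∫ v, ‖h v‖ ^ 2 :=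
    setIntegral_eq_integral_of_forall_compl_eq_zero fun x hx => by simp [hz x hx]
  rw [e1, ← e2]
  refine (norm_integral_ball_mul_sq_le (by fun_prop) h.continuous σ).trans (le_of_eq ?_)
  simp only [Complex.norm_exp_ofReal_mul_I]
  simp [Measure.real]

/-- Ingham's inequality with the sharp radius `2 √μ / g`. The weight is `(r² - |t|²) |𝓕 h|²`,
which is nonpositive outside the ball of radius `r`, where `h` is a dilated test function whose
Rayleigh quotient is close to the first eigenvalue; its integral against `|∑ x_k e^{i ω_k t}|²` is
`∑ |x_k|²` times `r² ∫ |h|² - (4π²)⁻¹ ∫ |∇h|²`. -/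
lemma sum_norm_sq_le_integral_ball_expSum (hμ : 0 < firstDirichletEigenvalue N) {g r : ℝ}
    (hg : 0 < g) (hr : 2 * √(firstDirichletEigenvalue N) / g < r) {K : Type*}
    (ω : K → EuclideanSpace ℝ (Fin N)) (s : Finset K)
    (hgap : ∀ k ∈ s, ∀ n ∈ s, k ≠ n → g ≤ ‖ω k - ω n‖) (x : K → ℂ) :
    (r ^ 2 - (2 * √(firstDirichletEigenvalue N) / g) ^ 2) / 2 * ∑ k ∈ s, ‖x k‖ ^ 2
      ≤ r ^ 2 * volume.real (ball (0 : EuclideanSpace ℝ (Fin N)) (g / (4 * Real.pi))) *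
        ∫ t in ball (0 : EuclideanSpace ℝ (Fin N)) r, ‖expSum ω s x t‖ ^ 2 := by
  set μ := firstDirichletEigenvalue N with hμdef
  have hpi := Real.pi_pos
  set ρ := 2 * √μ / g with hρ
  have hρ0 : 0 < ρ := by positivity
  have hρsq : ρ ^ 2 * g ^ 2 = 4 * μ := by
    rw [hρ, div_pow, mul_pow, Real.sq_sqrt hμ.le]; field_simp; norm_num
  have hr2 : ρ ^ 2 < r ^ 2 := by gcongr
  set q := g ^ 2 * (r ^ 2 + ρ ^ 2) / 8 with hq
  have hμq : μ < q := by
    have : g ^ 2 * ρ ^ 2 < g ^ 2 * r ^ 2 := by gcongr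
    rw [hq]; linarith
  obtain ⟨φ, hφ, hφpos, hray⟩ := exists_isTestFunction_rayleigh_le hμ hμq
  set σ := g / (4 * Real.pi) with hσ
  have hσ0 : 0 < σ := by positivity
  have hc : HasCompactSupport (fun x => ((φ (σ⁻¹ • x) : ℝ) : ℂ)) :=
    (hφ.2.1.comp_smul (inv_ne_zero hσ0.ne')).comp_left Complex.ofReal_zero
  have hd : ContDiff ℝ ((⊤ : ℕ∞) : WithTop ℕ∞) (fun x => ((φ (σ⁻¹ • x) : ℝ) : ℂ)) :=
    Complex.ofRealCLM.contDiff.comp (hφ.1.comp (contDiff_const_smul _))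
  set h : 𝓢(EuclideanSpace ℝ (Fin N), ℂ) := hc.toSchwartzMap hd with hh
  have hval : ∀ x, h x = ((φ (σ⁻¹ • x) : ℝ) : ℂ) := fun x => rfl
  have hout : ∀ x, σ ≤ ‖x‖ → σ⁻¹ • x ∉ ball (0 : EuclideanSpace ℝ (Fin N)) 1 := fun x hx => by
    rw [mem_ball_zero_iff, not_lt, norm_smul, norm_inv, Real.norm_of_nonneg hσ0.le]
    field_simp
    exact hx
  have hsupp : ∀ x, σ ≤ ‖x‖ → h x = 0 := fun x hx => by
    rw [hval, image_eq_zero_of_notMem_tsupport fun hh => hout x hx (hφ.2.2 hh)]; simp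
  let b := EuclideanSpace.basisFun (Fin N) ℝ
  have hder : ∀ i x, (∂_{b i} h : 𝓢(EuclideanSpace ℝ (Fin N), ℂ)) x
      = ((σ⁻¹ * inner ℝ (gradient φ (σ⁻¹ • x)) (b i) : ℝ) : ℂ) := by
    intro i x
    have hdφ : DifferentiableAt ℝ φ (σ⁻¹ • x) := (hφ.1.differentiable (by simp)) _
    have h1 : HasFDerivAt (fun y => φ (σ⁻¹ • y))
        ((fderiv ℝ φ (σ⁻¹ • x)).comp (σ⁻¹ • ContinuousLinearMap.id ℝ _)) x :=
      hdφ.hasFDerivAt.comp x ((hasFDerivAt_id x).const_smul σ⁻¹)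
    have h2 := Complex.ofRealCLM.hasFDerivAt.comp x h1
    rw [SchwartzMap.lineDerivOp_apply_eq_fderiv]
    have h3 : fderiv ℝ h x = Complex.ofRealCLM.comp
      ((fderiv ℝ φ (σ⁻¹ • x)).comp (σ⁻¹ • ContinuousLinearMap.id ℝ _)) := h2.fderiv
    rw [h3, gradient]
    simp
  have hdsupp : ∀ i x, σ ≤ ‖x‖ → (∂_{b i} h : 𝓢(EuclideanSpace ℝ (Fin N), ℂ)) x = 0 := by
    intro i x hx
    rw [hder, hφ.gradient_eq_zero (hout x hx)]
    simp
  set H := ∫ x, ‖h x‖ ^ 2 with hH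
  set S := ∑ k ∈ s, ‖x k‖ ^ 2 with hS
  have hS0 : 0 ≤ S := Finset.sum_nonneg fun _ _ => by positivity
  have hHval : H = σ ^ N * ∫ x, φ x ^ 2 := by
    have := Measure.integral_comp_inv_smul volume
      (fun y : EuclideanSpace ℝ (Fin N) => φ y ^ 2) σ
    rw [finrank_euclideanSpace_fin, abs_of_pos (by positivity), smul_eq_mul] at this
    rw [hH, ← this]
    simp [hval]
  have hHpos : 0 < H := by rw [hHval]; positivity
  have hDle : ∑ i, ∫ x, ‖(∂_{b i} h : 𝓢(EuclideanSpace ℝ (Fin N), ℂ)) x‖ ^ 2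
      ≤ (σ⁻¹) ^ 2 * q * H := by
    rw [← integral_finsetSum _ fun i _ => SchwartzMap.integrable_norm_sq _]
    have e : ∀ x, ∑ i, ‖(∂_{b i} h : 𝓢(EuclideanSpace ℝ (Fin N), ℂ)) x‖ ^ 2
        = (σ⁻¹) ^ 2 * ‖gradient φ (σ⁻¹ • x)‖ ^ 2 := by
      intro x
      simp_rw [hder, Complex.norm_real, norm_mul, mul_pow]
      rw [← Finset.mul_sum, b.sum_sq_norm_inner_left]
      simp
    simp_rw [e]
    have := Measure.integral_comp_inv_smul volume
      (fun y : EuclideanSpace ℝ (Fin N) => ‖gradient φ y‖ ^ 2) σ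
    rw [finrank_euclideanSpace_fin, abs_of_pos (by positivity), smul_eq_mul] at this
    rw [integral_const_mul, this, hHval]
    have h5 := mul_le_mul_of_nonneg_left hray (show 0 ≤ (σ⁻¹) ^ 2 * σ ^ N by positivity)
    linarith
  set f := expSum ω s x with hf
  obtain ⟨hint, heq⟩ := integral_norm_fourier_mul_expSum_sq h hsupp ω s hgap x
  have hD := fun i => integral_norm_fourier_mul_expSum_sq (∂_{b i} h) (hdsupp i) ω s hgap x
  set w : EuclideanSpace ℝ (Fin N) → ℝ := fun t => r ^ 2 * (‖𝓕 h t‖ ^ 2 * ‖f t‖ ^ 2) -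
    (4 * Real.pi ^ 2)⁻¹ * ∑ i, ‖𝓕 (∂_{b i} h) t‖ ^ 2 * ‖f t‖ ^ 2 with hw
  have hwval : ∀ t, w t = (r ^ 2 - ‖t‖ ^ 2) * (‖𝓕 h t‖ ^ 2 * ‖f t‖ ^ 2) := by
    intro t
    simp only [hw]
    rw [← Finset.sum_mul, ← SchwartzMap.norm_fourier_sq_mul_norm_sq b h t]
    field_simp
  have hi2 : Integrable fun t => ∑ i, ‖𝓕 (∂_{b i} h) t‖ ^ 2 * ‖f t‖ ^ 2 :=
    integrable_finsetSum _ fun i _ => (hD i).1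
  have hwint : Integrable w := (hint.const_mul _).sub (hi2.const_mul _)
  have hwI : (r ^ 2 - ρ ^ 2) / 2 * S * H ≤ ∫ t, w t := by
    rw [hw, integral_sub (hint.const_mul _) (hi2.const_mul _), integral_const_mul,
      integral_const_mul, integral_finsetSum _ fun i _ => (hD i).1, heq]
    simp_rw [(hD _).2]
    rw [← Finset.mul_sum]
    have h6 := mul_le_mul_of_nonneg_left hDle (show 0 ≤ (4 * Real.pi ^ 2)⁻¹ * S by positivity)
    have h7 : (4 * Real.pi ^ 2)⁻¹ * S * ((σ⁻¹) ^ 2 * q * H) = S * H * (r ^ 2 + ρ ^ 2) / 2 := by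
      rw [hq, hσ]; field_simp; ring
    rw [h7] at h6
    linarith
  have hup : ∫ t, w t ≤ ∫ t in ball (0 : EuclideanSpace ℝ (Fin N)) r,
      r ^ 2 * (volume.real (ball (0 : EuclideanSpace ℝ (Fin N)) σ) * H) * ‖f t‖ ^ 2 := by
    rw [← integral_indicator measurableSet_ball]
    refine integral_mono hwint
      ((((continuous_expSum ω s x).norm.pow 2).const_mul _).integrableOn_ball_zero
        r |>.integrable_indicator measurableSet_ball) fun t => ?_
    by_cases ht : t ∈ ball (0 : EuclideanSpace ℝ (Fin N)) r
    · rw [Set.indicator_of_mem ht, hwval]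
      have h8 := h.norm_fourier_sq_le_of_support hsupp t
      calc _ ≤ r ^ 2 * (‖𝓕 h t‖ ^ 2 * ‖f t‖ ^ 2) := by
            gcongr
            have := sq_nonneg ‖t‖
            linarith
        _ ≤ r ^ 2 * ((volume.real (ball (0 : EuclideanSpace ℝ (Fin N)) σ) * H) * ‖f t‖ ^ 2) := by
            gcongr
        _ = _ := by ring
    · rw [Set.indicator_of_notMem ht, hwval]
      have h9 : r ≤ ‖t‖ := by simpa using ht
      have h10 : r ^ 2 ≤ ‖t‖ ^ 2 := by have := hρ0.trans hr; gcongr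
      exact mul_nonpos_of_nonpos_of_nonneg (by linarith) (by positivity)
  rw [integral_const_mul] at hup
  refine le_of_mul_le_mul_right ?_ hHpos
  calc _ ≤ _ := hwI.trans hup
    _ = _ := by ring

end SingleFamily

/-! ### Biorthogonal functions and removal of families -/

section Combination

variable {E : Type*} [NormedAddCommGroup E] [InnerProductSpace ℝ E] {K : Type*}

lemma conj_expSum (ω : K → E) (s : Finset K) (x : K → ℂ) (t : E) :
    starRingEnd ℂ (expSum ω s x t) = ∑ k ∈ s, starRingEnd ℂ (x k) * wave (-ω k) t := by
  simp [expSum, wave_neg_left]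

variable [FiniteDimensional ℝ E] [MeasurableSpace E] [BorelSpace E]

lemma integral_ball_expSum_mul (ω : K → E) (s : Finset K) (x : K → ℂ) {φ : E → ℂ}
    (hφ : Continuous φ) (r : ℝ) (y : E) :
    ∫ t in ball (0 : E) r, expSum ω s x (y + t) * φ t
      = expSum ω s (fun k => x k * ∫ t in ball (0 : E) r, wave (ω k) t * φ t) y := by
  have h : ∀ t, expSum ω s x (y + t) * φ t
      = ∑ k ∈ s, (x k * wave (ω k) y) * (wave (ω k) t * φ t) := by
    intro t
    rw [expSum, Finset.sum_mul]
    exact Finset.sum_congr rfl fun k _ => by rw [wave_add_right]; ring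
  simp_rw [h]
  rw [integral_finsetSum, expSum]
  · refine Finset.sum_congr rfl fun k _ => ?_
    rw [integral_const_mul]
    ring
  · exact fun k _ => Continuous.integrableOn_ball_zero (by fun_prop) r

lemma integral_ball_wave_mul_conj_expSum (ω : K → E) (s : Finset K) (y : K → ℂ) (r : ℝ) (m : K) :
    ∫ t in ball (0 : E) r, wave (ω m) t * starRingEnd ℂ (expSum ω s y t)
      = ∑ n ∈ s, starRingEnd ℂ (y n) * ∫ t in ball (0 : E) r, wave (ω m) t * wave (-ω n) t := by
  simp_rw [conj_expSum, Finset.mul_sum]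
  rw [integral_finsetSum]
  · refine Finset.sum_congr rfl fun n _ => ?_
    rw [← integral_const_mul]
    exact integral_congr_ae (Eventually.of_forall fun t => by simp only; ring)
  · exact fun k _ => Continuous.integrableOn_ball_zero (by fun_prop) r

/-- If every coefficient of the exponential sums over `s` is controlled by the `L²` norm on a ball,
then there is a function on that ball, biorthogonal to the exponentials, which singles out the
coefficient of index `k`. It is the conjugate of an exponential sum: the lower bound makes the
Gram matrix of the exponentials invertible. -/
lemma exists_biorthogonal (ω : K → E) (s : Finset K) {r A : ℝ} (hA0 : 0 < A)
    (hA : ∀ x : K → ℂ, ∀ n ∈ s,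
      A * ‖x n‖ ^ 2 ≤ ∫ t in ball (0 : E) r, ‖expSum ω s x t‖ ^ 2) {k : K} (hk : k ∈ s) :
    ∃ φ : E → ℂ, Continuous φ ∧ ∫ t in ball (0 : E) r, wave (ω k) t * φ t = 1 ∧
      (∀ n ∈ s, n ≠ k → ∫ t in ball (0 : E) r, wave (ω n) t * φ t = 0) ∧
      A * ∫ t in ball (0 : E) r, ‖φ t‖ ^ 2 ≤ 1 := by
  classical
  let G : Matrix s s ℂ :=
    Matrix.of fun m n => ∫ t in ball (0 : E) r, wave (ω m) t * wave (-ω n) t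
  let ext : (s → ℂ) → K → ℂ := fun y n => if h : n ∈ s then starRingEnd ℂ (y ⟨n, h⟩) else 0
  have hext : ∀ (y : s → ℂ) (n : s), starRingEnd ℂ (ext y n) = y n := fun y n => by
    simp [ext]
  have hG : ∀ (y : s → ℂ) (m : s), G.mulVec y m
      = ∫ t in ball (0 : E) r, wave (ω m) t * starRingEnd ℂ (expSum ω s (ext y) t) := by
    intro y m
    rw [integral_ball_wave_mul_conj_expSum, Matrix.mulVec, dotProduct,
      ← Finset.sum_coe_sort s]
    refine Finset.sum_congr rfl fun n _ => ?_
    rw [hext, mul_comm]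
    rfl
  have hnorm : ∀ y : s → ℂ, ((∫ t in ball (0 : E) r, ‖expSum ω s (ext y) t‖ ^ 2 : ℝ) : ℂ)
      = ∑ m : s, ext y m * G.mulVec y m := by
    intro y
    rw [← integral_complex_ofReal]
    simp_rw [hG, ← integral_const_mul]
    rw [← integral_finsetSum _ fun m _ => Continuous.integrableOn_ball_zero
      (by have := Complex.continuous_conj; fun_prop) r]
    refine integral_congr_ae (Eventually.of_forall fun t => ?_)
    simp only
    rw [Finset.sum_coe_sort s
      (fun m => ext y m * (wave (ω m) t * starRingEnd ℂ (expSum ω s (ext y) t)))]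
    simp_rw [← mul_assoc]
    rw [← Finset.sum_mul, ← Complex.normSq_eq_norm_sq, Complex.normSq_eq_conj_mul_self, mul_comm]
    rfl
  have hinj : Function.Injective G.mulVecLin := by
    rw [← LinearMap.ker_eq_bot, LinearMap.ker_eq_bot']
    intro y hy
    have hy' : G.mulVec y = 0 := hy
    have h0 := hnorm y
    rw [hy'] at h0
    have h1 : ∫ t in ball (0 : E) r, ‖expSum ω s (ext y) t‖ ^ 2 = 0 := by
      rw [← Complex.ofReal_eq_zero, h0]
      simp
    funext n
    have h2 := hA (ext y) n n.2
    rw [h1] at h2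
    have h3 : ‖ext y n‖ ^ 2 ≤ 0 := by
      by_contra! h
      exact absurd h2 (not_le.2 (by positivity))
    have h4 : ext y n = 0 := by simpa using le_antisymm h3 (by positivity)
    rw [← hext y n, h4]
    simp
  obtain ⟨y, hy⟩ := LinearMap.injective_iff_surjective.1 hinj (Pi.single ⟨k, hk⟩ 1)
  have hy' : G.mulVec y = Pi.single ⟨k, hk⟩ 1 := hy
  refine ⟨fun t => starRingEnd ℂ (expSum ω s (ext y) t),
    Complex.continuous_conj.comp (continuous_expSum _ _ _), ?_, ?_, ?_⟩
  · rw [← hG y ⟨k, hk⟩, hy']; simp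
  · intro n hn hnk
    rw [← hG y ⟨n, hn⟩, hy', Pi.single_eq_of_ne]
    simpa using hnk
  · have h0 := hnorm y
    rw [hy'] at h0
    simp only [Pi.single_apply, mul_ite, mul_one, mul_zero, Finset.sum_ite_eq', Finset.mem_univ,
      if_true] at h0
    set J := ∫ t in ball (0 : E) r, ‖expSum ω s (ext y) t‖ ^ 2 with hJ
    have hJ0 : 0 ≤ J := integral_nonneg fun _ => by positivity
    have h1 : ‖ext y k‖ = J := by
      rw [← h0, Complex.norm_real, Real.norm_of_nonneg hJ0]
    have h2 := hA (ext y) k hk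
    rw [h1, ← hJ] at h2
    simp only [RCLike.norm_conj]
    rw [← hJ]
    rcases hJ0.eq_or_lt with h | h
    · rw [← h]; simp
    · refine le_of_mul_le_mul_right ?_ h
      linarith

/-- Convolution with the biorthogonal function of `k` removes the frequencies in `s₂`, so the
coefficient bounds for `s₁` and for `insert k s₂` combine, the radii being added. -/
lemma norm_sq_le_of_union [DecidableEq K] (ω : K → E) {s₁ s₂ : Finset K} (hdisj : Disjoint s₁ s₂)
    {k : K} (hk : k ∈ s₁) {r ρ A B : ℝ} (hA0 : 0 < A)
    (hA : ∀ x : K → ℂ, ∀ n ∈ insert k s₂,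
      A * ‖x n‖ ^ 2 ≤ ∫ t in ball (0 : E) r, ‖expSum ω (insert k s₂) x t‖ ^ 2)
    (hB : ∀ x : K → ℂ, B * ‖x k‖ ^ 2 ≤ ∫ t in ball (0 : E) ρ, ‖expSum ω s₁ x t‖ ^ 2)
    (x : K → ℂ) :
    A * B * ‖x k‖ ^ 2
      ≤ volume.real (ball (0 : E) r) *
        ∫ t in ball (0 : E) (ρ + r), ‖expSum ω (s₁ ∪ s₂) x t‖ ^ 2 := by
  obtain ⟨φ, hφc, hφk, hφ0, hφn⟩ := exists_biorthogonal ω (insert k s₂) hA0 hA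
    (Finset.mem_insert_self k s₂)
  set f := expSum ω (s₁ ∪ s₂) x with hf
  have hfc : Continuous f := continuous_expSum _ _ _
  set c : K → ℂ := fun n => ∫ t in ball (0 : E) r, wave (ω n) t * φ t with hc
  have hg : ∀ y, ∫ t in ball (0 : E) r, f (y + t) * φ t = expSum ω s₁ (fun n => x n * c n) y := by
    intro y
    rw [hf, integral_ball_expSum_mul ω _ x hφc, expSum, expSum, Finset.sum_union hdisj,
      add_eq_left]
    refine Finset.sum_eq_zero fun n hn => ?_
    rw [hφ0 n (Finset.mem_insert_of_mem hn) fun h => Finset.disjoint_left.1 hdisj hk (h ▸ hn)]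
    simp
  have h1 := hB (fun n => x n * c n)
  simp only [hc, hφk, mul_one] at h1
  set Φ := ∫ t in ball (0 : E) r, ‖φ t‖ ^ 2 with hΦ
  have hprod := Continuous.integrable_prod_ball (f := fun p : E × E => ‖f (p.1 + p.2)‖ ^ 2)
    (by fun_prop) ρ r
  have h2 : ∫ y in ball (0 : E) ρ, ‖expSum ω s₁ (fun n => x n * c n) y‖ ^ 2
      ≤ ∫ y in ball (0 : E) ρ, (∫ t in ball (0 : E) r, ‖f (y + t)‖ ^ 2) * Φ := by
    refine setIntegral_mono ?_ (hprod.integral_prod_left.mul_const _) fun y => ?_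
    · exact ((continuous_expSum _ _ _).norm.pow 2).integrableOn_ball_zero ρ
    · simp only
      rw [← hg y]
      exact norm_integral_ball_mul_sq_le (by fun_prop) hφc r
  rw [integral_mul_const] at h2
  set D := ∫ y in ball (0 : E) ρ, ∫ t in ball (0 : E) r, ‖f (y + t)‖ ^ 2 with hD
  have hD0 : 0 ≤ D := integral_nonneg fun _ => integral_nonneg fun _ => by positivity
  calc A * B * ‖x k‖ ^ 2 = A * (B * ‖x k‖ ^ 2) := by ring
    _ ≤ A * (D * Φ) := mul_le_mul_of_nonneg_left (h1.trans h2) hA0.le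
    _ = (A * Φ) * D := by ring
    _ ≤ 1 * D := by gcongr
    _ ≤ _ := by rw [one_mul]; exact integral_ball_integral_ball_le hfc

/-- Subtracting from `f` its translate by `y`, modulated so that the frequency `ω k` cancels,
multiplies the other coefficients by `1 - e^{i (ω n - ω k) · y}`. -/
lemma integral_ball_difference_le [DecidableEq K] (ω : K → E) {s : Finset K} {k : K} (hk : k ∉ s)
    (x : K → ℂ) (ρ : ℝ) (y : E) :
    ∫ t in ball (0 : E) ρ, ‖expSum ω s (fun n => x n * (1 - wave (ω n - ω k) y)) t‖ ^ 2
      ≤ 4 * ∫ t in ball (0 : E) (ρ + ‖y‖), ‖expSum ω (insert k s) x t‖ ^ 2 := by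
  set f := expSum ω (insert k s) x with hf
  have hfc : Continuous f := continuous_expSum _ _ _
  have h1 : ∀ t, expSum ω s (fun n => x n * (1 - wave (ω n - ω k) y)) t
      = f t - f (t + y) * wave (-ω k) y := by
    intro t
    rw [hf, expSum_add_right]
    simp only [expSum]
    rw [Finset.sum_insert hk, Finset.sum_insert hk, add_mul, Finset.sum_mul]
    have e : x k * wave (ω k) y * wave (ω k) t * wave (-ω k) y = x k * wave (ω k) t := by
      linear_combination (x k * wave (ω k) t) * wave_mul_wave_neg (ω k) y
    rw [e, add_sub_add_left_eq_sub, ← Finset.sum_sub_distrib]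
    exact Finset.sum_congr rfl fun n _ => by rw [wave_sub_left]; ring
  have h2 : ∀ t, ‖f t - f (t + y) * wave (-ω k) y‖ ^ 2 ≤ 2 * ‖f t‖ ^ 2 + 2 * ‖f (t + y)‖ ^ 2 := by
    intro t
    have h3 := norm_sub_le (f t) (f (t + y) * wave (-ω k) y)
    rw [norm_mul, norm_wave, mul_one] at h3
    have h4 := pow_le_pow_left₀ (norm_nonneg _) h3 2
    nlinarith [sq_nonneg (‖f t‖ - ‖f (t + y)‖)]
  simp_rw [h1]
  have i1 : IntegrableOn (fun t => 2 * ‖f t‖ ^ 2) (ball (0 : E) ρ) :=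
    Continuous.integrableOn_ball_zero (by fun_prop) ρ
  have i2 : IntegrableOn (fun t => 2 * ‖f (t + y)‖ ^ 2) (ball (0 : E) ρ) :=
    Continuous.integrableOn_ball_zero (by fun_prop) ρ
  have h5 := setIntegral_mono (Continuous.integrableOn_ball_zero (by fun_prop) ρ)
    (show IntegrableOn (fun t => 2 * ‖f t‖ ^ 2 + 2 * ‖f (t + y)‖ ^ 2) _ from i1.add i2) h2
  rw [integral_add i1 i2, integral_const_mul, integral_const_mul] at h5
  have h6 := integral_ball_shift_le hfc ρ y
  have h7 := integral_ball_mono_radius hfc (show ρ ≤ ρ + ‖y‖ by simp)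
  linarith

/-- Adding one frequency `ω n` to `s`: the shift `y` is taken along `ω k - ω n`, short enough that
the phase `(ω k - ω n) · y` stays within `[0, π]`. -/
lemma norm_sq_le_of_insert [DecidableEq K] (ω : K → E) {s : Finset K} {n k : K} (hn : n ∉ s)
    {ρ B δ g : ℝ} (hB0 : 0 ≤ B) (hδ : 0 < δ) (hg : 0 < g) (hgap : g ≤ ‖ω k - ω n‖)
    (hB : ∀ x : K → ℂ, B * ‖x k‖ ^ 2 ≤ ∫ t in ball (0 : E) ρ, ‖expSum ω s x t‖ ^ 2)
    (x : K → ℂ) :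
    B * (min (δ * g) Real.pi) ^ 2 * ‖x k‖ ^ 2
      ≤ Real.pi ^ 2 * ∫ t in ball (0 : E) (ρ + δ), ‖expSum ω (insert n s) x t‖ ^ 2 := by
  have hpi := Real.pi_pos
  set v := ω k - ω n with hv
  have hv0 : 0 < ‖v‖ := hg.trans_le hgap
  set θ := min (δ * ‖v‖) Real.pi with hθ
  have hθ0 : 0 < θ := by positivity
  set y : E := (θ / ‖v‖ ^ 2) • v with hy
  have hyn : ‖y‖ ≤ δ := by
    rw [hy, norm_smul, Real.norm_of_nonneg (by positivity)]
    have : θ ≤ δ * ‖v‖ := min_le_left _ _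
    rw [show θ / ‖v‖ ^ 2 * ‖v‖ = θ / ‖v‖ by field_simp, div_le_iff₀ hv0]
    exact this
  have hin : inner ℝ v y = θ := by
    rw [hy, inner_smul_right, real_inner_self_eq_norm_sq]
    field_simp
  have h1 := (hB (fun m => x m * (1 - wave (ω m - ω n) y))).trans
    (integral_ball_difference_le ω hn x ρ y)
  rw [norm_mul, mul_pow, ← hv, norm_sub_wave_sq, hin] at h1
  have h2 : Real.cos θ ≤ 1 - 2 / Real.pi ^ 2 * θ ^ 2 :=
    Real.cos_le_one_sub_mul_cos_sq (by rw [abs_of_pos hθ0]; exact min_le_right _ _)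
  have h3 : min (δ * g) Real.pi ≤ θ := min_le_min_right _ (by gcongr)
  have h4 : (min (δ * g) Real.pi) ^ 2 ≤ θ ^ 2 := by gcongr
  have h5 : 4 * θ ^ 2 ≤ Real.pi ^ 2 * (2 * (1 - Real.cos θ)) := by
    have : Real.pi ^ 2 * (2 / Real.pi ^ 2 * θ ^ 2) = 2 * θ ^ 2 := by field_simp
    nlinarith [sq_nonneg Real.pi]
  have h6 := integral_ball_mono_radius (continuous_expSum ω (insert n s) x)
    (show ρ + ‖y‖ ≤ ρ + δ by linarith)
  have h7 : B * ‖x k‖ ^ 2 * (4 * (min (δ * g) Real.pi) ^ 2)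
      ≤ B * ‖x k‖ ^ 2 * (Real.pi ^ 2 * (2 * (1 - Real.cos θ))) :=
    mul_le_mul_of_nonneg_left (by linarith) (by positivity)
  have h8 := mul_le_mul_of_nonneg_left (h1.trans (mul_le_mul_of_nonneg_left h6 zero_le_four))
    (sq_nonneg Real.pi)
  linarith

lemma mul_min_le_integral_one_sub_cos {τ : ℝ} (hτ : 0 < τ) (v : ℝ) :
    τ * min 1 ((v * τ) ^ 2) / 15 ≤ ∫ u in (0 : ℝ)..τ, (1 - Real.cos (v * u)) := by
  have hpi := Real.pi_gt_three
  have hpi2 : Real.pi ^ 2 < 10 := by nlinarith [Real.pi_lt_d2, Real.pi_pos]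
  wlog hv : 0 ≤ v generalizing v
  · have := this (-v) (by linarith)
    simpa using this
  by_cases h : v * τ ≤ 2
  · have h1 : ∫ u in (0 : ℝ)..τ, (2 / Real.pi ^ 2 * v ^ 2) * u ^ 2
        ≤ ∫ u in (0 : ℝ)..τ, (1 - Real.cos (v * u)) := by
      refine intervalIntegral.integral_mono_on hτ.le
        (Continuous.intervalIntegrable (by fun_prop) _ _)
        (Continuous.intervalIntegrable (by fun_prop) _ _) fun u hu => ?_
      have h2 : v * u ≤ v * τ := mul_le_mul_of_nonneg_left hu.2 hv
      have := Real.cos_le_one_sub_mul_cos_sq (x := v * u) (by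
        rw [abs_of_nonneg (mul_nonneg hv hu.1)]; linarith)
      linarith [mul_pow v u 2]
    rw [intervalIntegral.integral_const_mul, integral_pow] at h1
    have h2 : 1 / 15 ≤ 2 / Real.pi ^ 2 / 3 := by
      rw [div_div, div_le_div_iff₀ (by norm_num) (by positivity)]; linarith
    have h3 := min_le_right 1 ((v * τ) ^ 2)
    calc τ * min 1 ((v * τ) ^ 2) / 15 ≤ τ * (v * τ) ^ 2 * (1 / 15) := by
          rw [mul_one_div]; gcongr
      _ ≤ τ * (v * τ) ^ 2 * (2 / Real.pi ^ 2 / 3) := by gcongr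
      _ ≤ _ := le_trans (le_of_eq (by norm_num; ring)) h1
  · push Not at h
    have hv0 : 0 < v := by
      by_contra! hh
      nlinarith
    have h1 : ∫ u in (0 : ℝ)..τ, (1 - Real.cos (v * u)) = τ - Real.sin (v * τ) / v := by
      rw [intervalIntegral.integral_sub (Continuous.intervalIntegrable (by fun_prop) _ _)
        (Continuous.intervalIntegrable (by fun_prop) _ _),
        intervalIntegral.integral_comp_mul_left (fun u => Real.cos u) hv0.ne']
      simp
      ring
    have h2 : Real.sin (v * τ) / v ≤ τ / 2 := by
      rw [div_le_iff₀ hv0]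
      linarith [Real.sin_le_one (v * τ)]
    have h3 := min_le_left 1 ((v * τ) ^ 2)
    rw [h1]
    nlinarith

/-- If the sums over `s` satisfy a lower bound and all frequencies of `s` are at distance at least
`g` from `ω k`, the coefficients over `s` stay controlled after adding the frequency `ω k`: the
bounds for the differences along the coordinate directions are averaged over the step size. -/
lemma sum_norm_sq_le_of_insert [DecidableEq K] (ω : K → E) {s : Finset K} {k : K} (hk : k ∉ s)
    {ρ a g τ : ℝ} (ha0 : 0 ≤ a) (hg : 0 ≤ g) (hτ : 0 < τ)
    (hgap : ∀ n ∈ s, g ≤ ‖ω n - ω k‖)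
    (ha : ∀ x : K → ℂ, a * ∑ n ∈ s, ‖x n‖ ^ 2 ≤ ∫ t in ball (0 : E) ρ, ‖expSum ω s x t‖ ^ 2)
    (x : K → ℂ) :
    a * min 1 ((g * τ) ^ 2 / Module.finrank ℝ E) * ∑ n ∈ s, ‖x n‖ ^ 2
      ≤ 30 * Module.finrank ℝ E *
        ∫ t in ball (0 : E) (ρ + τ), ‖expSum ω (insert k s) x t‖ ^ 2 := by
  set d := Module.finrank ℝ E with hd
  set I := ∫ t in ball (0 : E) (ρ + τ), ‖expSum ω (insert k s) x t‖ ^ 2 with hI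
  set b := stdOrthonormalBasis ℝ E with hb
  set v : K → Fin d → ℝ := fun n i => inner ℝ (ω n - ω k) (b i) with hv
  set m := min 1 ((g * τ) ^ 2 / (d : ℝ)) with hm
  have h1 : ∀ i, ∀ u ∈ Set.Icc 0 τ,
      a * ∑ n ∈ s, ‖x n‖ ^ 2 * (2 * (1 - Real.cos (v n i * u))) ≤ 4 * I := by
    intro i u hu
    have h2 := (ha _).trans (integral_ball_difference_le ω hk x ρ (u • b i))
    simp only [norm_mul, mul_pow, norm_sub_wave_sq, inner_smul_right] at h2
    have h3 : ‖u • b i‖ ≤ τ := by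
      rw [norm_smul, b.norm_eq_one, mul_one, Real.norm_of_nonneg hu.1]
      exact hu.2
    refine le_trans (le_of_eq ?_) (h2.trans (mul_le_mul_of_nonneg_left
      (integral_ball_mono_radius (continuous_expSum _ _ _) (by linarith)) zero_le_four))
    congr 1
    exact Finset.sum_congr rfl fun n _ => by simp only [hv]; rw [mul_comm u]
  have h4 : ∀ i, a * ∑ n ∈ s, ‖x n‖ ^ 2 * (2 * (τ * min 1 ((v n i * τ) ^ 2) / 15))
      ≤ 4 * I * τ := by
    intro i
    have h5 := intervalIntegral.integral_mono_on (μ := volume) hτ.le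
      (Continuous.intervalIntegrable (by fun_prop) _ _)
      (Continuous.intervalIntegrable (by fun_prop) _ _) (h1 i)
    rw [intervalIntegral.integral_const, intervalIntegral.integral_const_mul,
      intervalIntegral.integral_finsetSum
        fun n _ => Continuous.intervalIntegrable (by fun_prop) _ _, smul_eq_mul, sub_zero] at h5
    simp_rw [intervalIntegral.integral_const_mul] at h5
    have h6 : ∑ n ∈ s, ‖x n‖ ^ 2 * (2 * (τ * min 1 ((v n i * τ) ^ 2) / 15))
        ≤ ∑ n ∈ s, ‖x n‖ ^ 2 * (2 * ∫ u in (0 : ℝ)..τ, (1 - Real.cos (v n i * u))) := by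
      refine Finset.sum_le_sum fun n _ => ?_
      have := mul_min_le_integral_one_sub_cos hτ (v n i)
      gcongr
    linarith [mul_le_mul_of_nonneg_left h6 ha0]
  have h7 := Finset.sum_le_sum fun i (_ : i ∈ Finset.univ) => h4 i
  rw [← Finset.mul_sum, Finset.sum_comm, Finset.sum_const, Finset.card_univ, Fintype.card_fin,
    nsmul_eq_mul] at h7
  have h8 : ∀ n ∈ s, 2 * τ / 15 * m * ‖x n‖ ^ 2
      ≤ ∑ i, ‖x n‖ ^ 2 * (2 * (τ * min 1 ((v n i * τ) ^ 2) / 15)) := by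
    intro n hn
    -- some coordinate of `ω n - ω k` has square at least `g² / d`
    have h9 : m ≤ ∑ i, min 1 ((v n i * τ) ^ 2) := by
      have h10 : ∑ i, v n i ^ 2 = ‖ω n - ω k‖ ^ 2 := b.sum_sq_inner_left _
      by_cases h11 : ∃ i, 1 ≤ (v n i * τ) ^ 2
      · obtain ⟨i, hi⟩ := h11
        refine (min_le_left _ _).trans ((le_min le_rfl hi).trans
          (Finset.single_le_sum (f := fun i => min 1 ((v n i * τ) ^ 2))
            (fun i _ => by positivity) (Finset.mem_univ i)))
      · push Not at h11
        rw [Finset.sum_congr rfl fun i _ => min_eq_right (h11 i).le]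
        simp_rw [mul_pow]
        rw [← Finset.sum_mul, h10]
        refine (min_le_right _ _).trans ?_
        rcases Nat.eq_zero_or_pos d with h | h
        · rw [h]; simp; positivity
        · have h12 : (1 : ℝ) ≤ d := by exact_mod_cast h
          refine (div_le_self (by positivity) h12).trans ?_
          rw [mul_pow]
          have := hgap n hn
          gcongr
    rw [← Finset.mul_sum, ← Finset.mul_sum, ← Finset.sum_div, ← Finset.mul_sum]
    have := mul_le_mul_of_nonneg_left h9 (show 0 ≤ 2 * τ / 15 * ‖x n‖ ^ 2 by positivity)
    linarith
  have h13 := Finset.sum_le_sum h8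
  rw [← Finset.mul_sum] at h13
  have h14 := mul_le_mul_of_nonneg_left h13 ha0
  refine le_of_mul_le_mul_right ?_ (show 0 < 2 * τ / 15 by positivity)
  linarith

/-- The dual form of a Bessel inequality. -/
lemma sum_norm_integral_ball_sq_le (ω : K → E) (s : Finset K) {ε C : ℝ} (hC0 : 0 ≤ C)
    (hC : ∀ x : K → ℂ, ∫ t in ball (0 : E) ε, ‖expSum ω s x t‖ ^ 2 ≤ C * ∑ k ∈ s, ‖x k‖ ^ 2)
    {f : E → ℂ} (hf : Continuous f) :
    ∑ k ∈ s, ‖∫ t in ball (0 : E) ε, f t * wave (-ω k) t‖ ^ 2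
      ≤ C * ∫ t in ball (0 : E) ε, ‖f t‖ ^ 2 := by
  set z : K → ℂ := fun k => ∫ t in ball (0 : E) ε, f t * wave (-ω k) t with hz
  set S := ∑ k ∈ s, ‖z k‖ ^ 2 with hS
  have hS0 : 0 ≤ S := Finset.sum_nonneg fun _ _ => by positivity
  have hcc := Complex.continuous_conj
  have h1 : (S : ℂ) = ∫ t in ball (0 : E) ε, f t * starRingEnd ℂ (expSum ω s z t) := by
    simp_rw [conj_expSum, Finset.mul_sum]
    rw [integral_finsetSum _ fun k _ => Continuous.integrableOn_ball_zero (by fun_prop) ε, hS]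
    push_cast
    refine Finset.sum_congr rfl fun k _ => ?_
    rw [← Complex.conj_mul', ← integral_const_mul]
    exact integral_congr_ae (Eventually.of_forall fun t => by simp only; ring)
  have h2 := norm_integral_ball_mul_sq_le hf
    (hcc.comp (continuous_expSum ω s z)) ε
  simp only [Function.comp_apply, RCLike.norm_conj] at h2
  rw [← h1, Complex.norm_real, Real.norm_of_nonneg hS0] at h2
  set P := ∫ t in ball (0 : E) ε, ‖f t‖ ^ 2 with hP
  have hP0 : 0 ≤ P := integral_nonneg fun _ => by positivity
  have h3 : S ^ 2 ≤ P * (C * S) := h2.trans (mul_le_mul_of_nonneg_left (hC z) hP0)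
  rcases hS0.eq_or_lt with h | h
  · rw [← h]; positivity
  · refine le_of_mul_le_mul_right ?_ h
    linarith

/-- Bounds for the individual coefficients on a ball yield an `ℓ²` bound on a larger ball: the
bound for index `k` is applied to the averages of `f` against `e^{-i ω_k · y}` over a small ball,
and the averages are summed by the dual Bessel inequality. -/
lemma sum_norm_sq_le_of_forall_norm_sq_le (ω : K → E) (s : Finset K) {ρ ε B C : ℝ} (hε : 0 < ε)
    (hC0 : 0 ≤ C)
    (hC : ∀ x : K → ℂ, ∫ t in ball (0 : E) ε, ‖expSum ω s x t‖ ^ 2 ≤ C * ∑ k ∈ s, ‖x k‖ ^ 2)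
    (hB : ∀ x : K → ℂ, ∀ k ∈ s,
      B * ‖x k‖ ^ 2 ≤ ∫ t in ball (0 : E) ρ, ‖expSum ω s x t‖ ^ 2) (x : K → ℂ) :
    B * volume.real (ball (0 : E) ε) * ∑ k ∈ s, ‖x k‖ ^ 2
      ≤ C * ∫ t in ball (0 : E) (ρ + ε), ‖expSum ω s x t‖ ^ 2 := by
  set f := expSum ω s x with hf
  have hfc : Continuous f := continuous_expSum _ _ _
  set V := volume.real (ball (0 : E) ε) with hV
  have hV0 : 0 < V := ENNReal.toReal_pos (measure_ball_pos _ _ hε).ne' measure_ball_lt_top.ne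
  set c : K → K → ℂ := fun k n => ∫ y in ball (0 : E) ε, wave (ω n) y * wave (-ω k) y with hc
  have hckk : ∀ k, c k k = V := fun k => by
    simp only [hc, wave_mul_wave_neg]
    simp [hV, Measure.real]
  have h1 : ∀ k ∈ s, B * V ^ 2 * ‖x k‖ ^ 2
      ≤ ∫ t in ball (0 : E) ρ, ‖∫ y in ball (0 : E) ε, f (t + y) * wave (-ω k) y‖ ^ 2 := by
    intro k hk
    have h2 := hB (fun n => x n * c k n) k hk
    simp only [hckk, norm_mul, mul_pow, Complex.norm_real, Real.norm_of_nonneg hV0.le] at h2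
    refine le_trans (le_of_eq (by ring)) (h2.trans (le_of_eq ?_))
    refine integral_congr_ae (Eventually.of_forall fun t => ?_)
    simp only
    rw [hf, integral_ball_expSum_mul ω s x (continuous_wave _)]
  have hint : ∀ k ∈ s, IntegrableOn
      (fun t => ‖∫ y in ball (0 : E) ε, f (t + y) * wave (-ω k) y‖ ^ 2) (ball (0 : E) ρ) := by
    intro k _
    simp_rw [hf, integral_ball_expSum_mul ω s x (continuous_wave _)]
    exact Continuous.integrableOn_ball_zero (by fun_prop) ρ
  have hprod := Continuous.integrable_prod_ball (f := fun p : E × E => ‖f (p.1 + p.2)‖ ^ 2)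
    (by fun_prop) ρ ε
  have h3 : ∑ k ∈ s, ∫ t in ball (0 : E) ρ, ‖∫ y in ball (0 : E) ε, f (t + y) * wave (-ω k) y‖ ^ 2
      ≤ ∫ t in ball (0 : E) ρ, C * ∫ y in ball (0 : E) ε, ‖f (t + y)‖ ^ 2 := by
    rw [← integral_finsetSum _ hint]
    refine setIntegral_mono (integrable_finsetSum _ hint) (hprod.integral_prod_left.const_mul C)
      fun t => ?_
    exact sum_norm_integral_ball_sq_le ω s hC0 hC (by fun_prop)
  rw [integral_const_mul] at h3
  have h4 := integral_ball_integral_ball_le hfc (r := ρ) (ρ := ε)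
  have h5 := Finset.sum_le_sum h1
  rw [← Finset.mul_sum] at h5
  have h6 := mul_le_mul_of_nonneg_left h4 hC0
  refine le_of_mul_le_mul_right ?_ hV0
  linarith

end Combination

/-! ### Passage to infinite sums -/

section Limit

variable {N : ℕ} {K : Type*}

/-- Two-sided bounds for finite exponential sums extend to square summable families: the upper
bound gives unconditional convergence in `L²`, and both bounds pass to the limit. -/
lemma exists_isExpSumInL2_of_finite (ω : K → EuclideanSpace ℝ (Fin N)) {R a C : ℝ} (hC0 : 0 < C)
    (hC : ∀ (s : Finset K) (x : K → ℂ), ∫ t in ball (0 : EuclideanSpace ℝ (Fin N)) R,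
      ‖expSum ω s x t‖ ^ 2 ≤ C * ∑ k ∈ s, ‖x k‖ ^ 2)
    (ha : ∀ (s : Finset K) (x : K → ℂ), a * ∑ k ∈ s, ‖x k‖ ^ 2
      ≤ ∫ t in ball (0 : EuclideanSpace ℝ (Fin N)) R, ‖expSum ω s x t‖ ^ 2)
    (x : K → ℂ) (hx : Summable fun k => ‖x k‖ ^ 2) :
    ∃ f : EuclideanSpace ℝ (Fin N) → ℂ, IsExpSumInL2 (ball 0 R) ω x f ∧
      a * ∑' k, ‖x k‖ ^ 2 ≤ ∫ t in ball (0 : EuclideanSpace ℝ (Fin N)) R, ‖f t‖ ^ 2 ∧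
      ∫ t in ball (0 : EuclideanSpace ℝ (Fin N)) R, ‖f t‖ ^ 2 ≤ C * ∑' k, ‖x k‖ ^ 2 := by
  classical
  set ν := (volume : Measure (EuclideanSpace ℝ (Fin N))).restrict (ball 0 R) with hν
  have hmem : ∀ {g : EuclideanSpace ℝ (Fin N) → ℂ}, Continuous g → MemLp g 2 ν := fun hg =>
    (memLp_two_iff_integrable_sq_norm hg.aestronglyMeasurable).2
      ((hg.norm.pow 2).integrableOn_ball_zero R)
  let V : K → Lp ℂ 2 ν := fun k =>
    (hmem (g := fun t => x k * wave (ω k) t) (by fun_prop)).toLp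
  have hV : ∀ s : Finset K, ⇑(∑ k ∈ s, V k) =ᵐ[ν] expSum ω s x := by
    intro s
    induction s using Finset.induction_on with
    | empty =>
      rw [Finset.sum_empty]
      filter_upwards [Lp.coeFn_zero ℂ 2 ν] with t ht
      rw [ht]
      simp [expSum]
    | insert k s hk ih =>
      rw [Finset.sum_insert hk]
      filter_upwards [Lp.coeFn_add (V k) (∑ k ∈ s, V k), ih, MemLp.coeFn_toLp
        (hmem (g := fun t => x k * wave (ω k) t) (by fun_prop))] with t h1 h2 h3
      rw [h1, Pi.add_apply, h2, h3, expSum, expSum, Finset.sum_insert hk]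
  have hVn : ∀ s : Finset K, ‖∑ k ∈ s, V k‖ ^ 2
      = ∫ t in ball (0 : EuclideanSpace ℝ (Fin N)) R, ‖expSum ω s x t‖ ^ 2 := by
    intro s
    rw [Lp.norm_def, eLpNorm_congr_ae (hV s),
      ← integral_norm_sq_eq_toReal_eLpNorm (hmem (continuous_expSum ω s x))]
  have hsum : Summable V := by
    rw [summable_iff_vanishing_norm]
    intro ε hε
    obtain ⟨s, hs⟩ := summable_iff_vanishing_norm.1 hx (ε ^ 2 / C) (by positivity)
    refine ⟨s, fun t ht => ?_⟩
    have h1 := hs t ht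
    rw [Real.norm_of_nonneg (Finset.sum_nonneg fun _ _ => by positivity), lt_div_iff₀ hC0] at h1
    have h2 := hC t x
    rw [← hVn] at h2
    exact lt_of_pow_lt_pow_left₀ 2 hε.le (by linarith)
  obtain ⟨F, hF⟩ := hsum
  have hFn : ∫ t in ball (0 : EuclideanSpace ℝ (Fin N)) R, ‖F t‖ ^ 2 = ‖F‖ ^ 2 := by
    rw [Lp.norm_def, ← integral_norm_sq_eq_toReal_eLpNorm (Lp.memLp F)]
  have hlim : Tendsto (fun s : Finset K => ‖∑ k ∈ s, V k‖ ^ 2) atTop (𝓝 (‖F‖ ^ 2)) :=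
    (Tendsto.norm hF).pow 2
  simp_rw [hVn] at hlim
  have hxs : Tendsto (fun s : Finset K => ∑ k ∈ s, ‖x k‖ ^ 2) atTop (𝓝 (∑' k, ‖x k‖ ^ 2)) :=
    hx.hasSum
  refine ⟨F, ⟨Lp.memLp F, ?_⟩, ?_, ?_⟩
  · have h1 := (Lp.tendsto_Lp_iff_tendsto_eLpNorm' _ _).1
      (show Tendsto (fun s : Finset K => ∑ k ∈ s, V k) atTop (𝓝 F) from hF)
    refine h1.congr fun s => eLpNorm_congr_ae ?_
    filter_upwards [hV s] with t ht
    simp only [Pi.sub_apply, ht]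
    rfl
  · rw [hFn]
    exact le_of_tendsto_of_tendsto' (hxs.const_mul a) hlim fun s => ha s x
  · rw [hFn]
    exact le_of_tendsto_of_tendsto' hlim (hxs.const_mul C) fun s => hC s x

end Limit

/-! ### Dependence of the constants on the excess of the radius -/

section Quantitative

variable {N : ℕ}

@[simp] lemma criticalRadius_top (N : ℕ) : criticalRadius N ∞ = 0 := by simp [criticalRadius]

lemma criticalRadius_ofReal (N : ℕ) {g : ℝ} (hg : 0 < g) :
    criticalRadius N (ENNReal.ofReal g) = 2 * √(firstDirichletEigenvalue N) / g := by
  rw [criticalRadius, ← ENNReal.ofReal_div_of_pos hg, ENNReal.toReal_ofReal (by positivity)]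

lemma criticalRadius_nonneg (N : ℕ) (G : ℝ≥0∞) : 0 ≤ criticalRadius N G := ENNReal.toReal_nonneg

lemma criticalRadius_eq_zero_of_firstDirichletEigenvalue_nonpos
    (h : firstDirichletEigenvalue N ≤ 0) (G : ℝ≥0∞) : criticalRadius N G = 0 := by
  simp [criticalRadius, Real.sqrt_eq_zero_of_nonpos h]

lemma volume_real_ball_pos {r : ℝ} (hr : 0 < r) :
    0 < volume.real (ball (0 : EuclideanSpace ℝ (Fin N)) r) :=
  ENNReal.toReal_pos (measure_ball_pos _ _ hr).ne' measure_ball_lt_top.ne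

lemma volume_real_ball_eq {r : ℝ} (hr : 0 < r) :
    volume.real (ball (0 : EuclideanSpace ℝ (Fin N)) r)
      = r ^ N * volume.real (ball (0 : EuclideanSpace ℝ (Fin N)) 1) := by
  rw [Measure.real, Measure.addHaar_ball_of_pos _ _ hr, ENNReal.toReal_mul,
    ENNReal.toReal_ofReal (by positivity), finrank_euclideanSpace_fin, Measure.real]

lemma volume_real_ball_mono {r r' : ℝ} (h : r ≤ r') :
    volume.real (ball (0 : EuclideanSpace ℝ (Fin N)) r)
      ≤ volume.real (ball (0 : EuclideanSpace ℝ (Fin N)) r') :=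
  ENNReal.toReal_mono measure_ball_lt_top.ne (measure_mono (ball_subset_ball h))

lemma integral_ball_norm_mul_wave_sq (w : EuclideanSpace ℝ (Fin N)) (z : ℂ) (r : ℝ) :
    ∫ t in ball (0 : EuclideanSpace ℝ (Fin N)) r, ‖z * wave w t‖ ^ 2
      = volume.real (ball (0 : EuclideanSpace ℝ (Fin N)) r) * ‖z‖ ^ 2 := by
  simp [Measure.real]

/-- A form of `sum_norm_sq_le_integral_ball_expSum` that is linear in the excess `δ` of the
radius. -/
lemma exists_mul_sum_norm_sq_le (hμ : 0 < firstDirichletEigenvalue N) {g T : ℝ} (hg : 0 < g)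
    (hgT : 2 * √(firstDirichletEigenvalue N) / g ≤ T) :
    ∃ κ : ℝ, 0 < κ ∧ ∀ {K : Type*} (ω : K → EuclideanSpace ℝ (Fin N)) (s : Finset K),
      (∀ k ∈ s, ∀ n ∈ s, k ≠ n → g ≤ ‖ω k - ω n‖) → ∀ δ, 0 < δ → δ ≤ T → ∀ x : K → ℂ,
        κ * δ * ∑ k ∈ s, ‖x k‖ ^ 2 ≤ ∫ t in ball (0 : EuclideanSpace ℝ (Fin N))
          (2 * √(firstDirichletEigenvalue N) / g + δ), ‖expSum ω s x t‖ ^ 2 := by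
  set ρ := 2 * √(firstDirichletEigenvalue N) / g with hρ
  have hρ0 : 0 < ρ := by positivity
  have hT : 0 < T := hρ0.trans_le hgT
  set v := volume.real (ball (0 : EuclideanSpace ℝ (Fin N)) (g / (4 * Real.pi))) with hv
  have hv0 : 0 < v := volume_real_ball_pos (by have := Real.pi_pos; positivity)
  refine ⟨ρ / (4 * T ^ 2 * v), by positivity, ?_⟩
  intro K ω s hgap δ hδ hδT x
  have h1 := sum_norm_sq_le_integral_ball_expSum hμ hg
    (show ρ < ρ + δ by linarith) ω s hgap x
  set I := ∫ t in ball (0 : EuclideanSpace ℝ (Fin N)) (ρ + δ), ‖expSum ω s x t‖ ^ 2 with hI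
  have hI0 : 0 ≤ I := integral_nonneg fun _ => by positivity
  have hS0 : 0 ≤ ∑ k ∈ s, ‖x k‖ ^ 2 := Finset.sum_nonneg fun _ _ => by positivity
  have h2 : (ρ + δ) ^ 2 ≤ 4 * T ^ 2 := by nlinarith
  have h3 : ρ * δ ≤ ((ρ + δ) ^ 2 - ρ ^ 2) / 2 := by nlinarith
  have h4 : ρ * δ * ∑ k ∈ s, ‖x k‖ ^ 2 ≤ 4 * T ^ 2 * v * I :=
    (mul_le_mul_of_nonneg_right h3 hS0).trans (h1.trans (by gcongr))
  rw [div_mul_eq_mul_div, div_mul_eq_mul_div, div_le_iff₀ (by positivity)]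
  linarith

/-- The coefficient bound for a single family with gap `G`, at cost `δ ^ N`. -/
lemma exists_coefficient_bound (hN : 1 ≤ N) (hμ : 0 < firstDirichletEigenvalue N) {G : ℝ≥0∞}
    (hG : G ≠ 0) {T : ℝ} (hT : 0 < T) (hGT : criticalRadius N G ≤ T) :
    ∃ κ : ℝ, 0 < κ ∧ ∀ {K : Type*} (ω : K → EuclideanSpace ℝ (Fin N)) (s : Finset K),
      (∀ k ∈ s, ∀ n ∈ s, k ≠ n → G ≤ ENNReal.ofReal ‖ω k - ω n‖) →
      ∀ δ, 0 < δ → δ ≤ T → ∀ x : K → ℂ, ∀ k ∈ s,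
        κ * δ ^ N * ‖x k‖ ^ 2 ≤ ∫ t in ball (0 : EuclideanSpace ℝ (Fin N))
          (criticalRadius N G + δ), ‖expSum ω s x t‖ ^ 2 := by
  by_cases hGt : G = ∞
  · subst hGt
    refine ⟨volume.real (ball (0 : EuclideanSpace ℝ (Fin N)) 1), volume_real_ball_pos one_pos, ?_⟩
    intro K ω s hgap δ hδ _ x k hk
    have hs : s = {k} := by
      refine Finset.eq_singleton_iff_unique_mem.2 ⟨hk, fun n hn => ?_⟩
      by_contra hnk
      exact absurd (hgap n hn k hk hnk) (by simp)
    subst hs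
    simp only [expSum, Finset.sum_singleton, criticalRadius_top, zero_add]
    rw [integral_ball_norm_mul_wave_sq, volume_real_ball_eq hδ]
    exact le_of_eq (by ring)
  · obtain ⟨g, hg, rfl⟩ : ∃ g : ℝ, 0 < g ∧ G = ENNReal.ofReal g :=
      ⟨G.toReal, ENNReal.toReal_pos hG hGt, (ENNReal.ofReal_toReal hGt).symm⟩
    rw [criticalRadius_ofReal N hg] at hGT ⊢
    obtain ⟨κ, hκ, h⟩ := exists_mul_sum_norm_sq_le hμ hg hGT
    refine ⟨κ / T ^ (N - 1), by positivity, ?_⟩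
    intro K ω s hgap δ hδ hδT x k hk
    have h1 := h ω s (fun k hk n hn hkn =>
      (ENNReal.ofReal_le_ofReal_iff (norm_nonneg _)).1 (hgap k hk n hn hkn)) δ hδ hδT x
    refine le_trans ?_ h1
    have h2 : ‖x k‖ ^ 2 ≤ ∑ k ∈ s, ‖x k‖ ^ 2 :=
      Finset.single_le_sum (f := fun k => ‖x k‖ ^ 2) (fun _ _ => by positivity) hk
    have h3 : κ / T ^ (N - 1) * δ ^ N ≤ κ * δ := by
      rw [div_mul_eq_mul_div, div_le_iff₀ (by positivity), ← Nat.sub_add_cancel hN, pow_succ,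
        Nat.add_sub_cancel]
      have : δ ^ (N - 1) ≤ T ^ (N - 1) := by gcongr
      have := mul_le_mul_of_nonneg_left this (show 0 ≤ κ * δ by positivity)
      linarith
    gcongr

/-- All coefficients over `insert k s` are controlled on a ball slightly larger than the critical
one for the gap `g` of `s`, at cost `δ ^ 3`, even if `ω k` is only `γ`-separated from `s`. -/
lemma exists_coefficient_bound_insert (hN : 1 ≤ N) (hμ : 0 < firstDirichletEigenvalue N)
    {g γ T : ℝ} (hg : 0 < g) (hγ : 0 < γ) (hgT : 2 * √(firstDirichletEigenvalue N) / g ≤ T) :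
    ∃ κ : ℝ, 0 < κ ∧ ∀ {K : Type*} [DecidableEq K] (ω : K → EuclideanSpace ℝ (Fin N))
      (s : Finset K) (k : K), k ∉ s → (∀ k ∈ s, ∀ n ∈ s, k ≠ n → g ≤ ‖ω k - ω n‖) →
      (∀ n ∈ s, γ ≤ ‖ω n - ω k‖) → ∀ δ, 0 < δ → δ ≤ T → ∀ x : K → ℂ, ∀ n ∈ insert k s,
        κ * δ ^ 3 * ‖x n‖ ^ 2 ≤ ∫ t in ball (0 : EuclideanSpace ℝ (Fin N))
          (2 * √(firstDirichletEigenvalue N) / g + δ), ‖expSum ω (insert k s) x t‖ ^ 2 := by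
  set ρ := 2 * √(firstDirichletEigenvalue N) / g with hρ
  have hρ0 : 0 < ρ := by positivity
  have hT : 0 < T := hρ0.trans_le hgT
  have hN0 : (0 : ℝ) < N := by exact_mod_cast hN
  obtain ⟨κ, hκ, hlow⟩ := exists_mul_sum_norm_sq_le hμ hg hgT
  obtain ⟨C, hC, hup⟩ := exists_integral_ball_expSum_le (E := EuclideanSpace ℝ (Fin N)) hg (2 * T)
  set c := min (1 / T ^ 2) (γ ^ 2 / (4 * N)) with hc
  have hc0 : 0 < c := by positivity
  set b := κ / 2 * c with hb
  have hb0 : 0 < b := by positivity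
  set V := volume.real (ball (0 : EuclideanSpace ℝ (Fin N)) ρ) with hV
  have hV0 : 0 < V := volume_real_ball_pos hρ0
  set D := 2 * b * T ^ 3 + 60 * C * N + 30 * N with hD
  have hD0 : 0 < D := by positivity
  refine ⟨b * min 1 V / D, by positivity, ?_⟩
  intro K _ ω s k hk hgap hgapk δ hδ hδT x
  set I := ∫ t in ball (0 : EuclideanSpace ℝ (Fin N)) (ρ + δ),
    ‖expSum ω (insert k s) x t‖ ^ 2 with hI
  have hI0 : 0 ≤ I := integral_nonneg fun _ => by positivity
  set S := ∑ n ∈ s, ‖x n‖ ^ 2 with hS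
  have hS0 : 0 ≤ S := Finset.sum_nonneg fun _ _ => by positivity
  -- half of the excess `δ` is used for the single family, half for the differences
  have h1 := sum_norm_sq_le_of_insert ω hk (ρ := ρ + δ / 2) (a := κ * (δ / 2)) (τ := δ / 2)
    (by positivity) hγ.le (by positivity) hgapk
    (fun x => hlow ω s hgap (δ / 2) (by positivity) (by linarith) x) x
  rw [finrank_euclideanSpace_fin, show ρ + δ / 2 + δ / 2 = ρ + δ by ring, ← hI, ← hS] at h1
  have h2 : c * δ ^ 2 ≤ min 1 ((γ * (δ / 2)) ^ 2 / N) := by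
    refine le_min ?_ ?_
    · calc c * δ ^ 2 ≤ 1 / T ^ 2 * T ^ 2 := by gcongr; exact min_le_left _ _
        _ = 1 := by field_simp
    · calc c * δ ^ 2 ≤ γ ^ 2 / (4 * N) * δ ^ 2 := by gcongr; exact min_le_right _ _
        _ = _ := by field_simp; norm_num
  have h3 : b * δ ^ 3 * S ≤ 30 * N * I := by
    refine le_trans ?_ h1
    calc b * δ ^ 3 * S = κ * (δ / 2) * (c * δ ^ 2) * S := by rw [hb]; ring
      _ ≤ _ := by gcongr
  have hδ3 : δ ^ 3 ≤ T ^ 3 := by gcongr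
  have h4 : b * δ ^ 3 * V * ‖x k‖ ^ 2 ≤ D * I := by
    have h5 : V * ‖x k‖ ^ 2 ≤ 2 * I + 2 * (C * S) := by
      have h6 : ∀ t, ‖x k * wave (ω k) t‖ ^ 2
          ≤ 2 * ‖expSum ω (insert k s) x t‖ ^ 2 + 2 * ‖expSum ω s x t‖ ^ 2 := by
        intro t
        have e : x k * wave (ω k) t = expSum ω (insert k s) x t - expSum ω s x t := by
          simp [expSum, Finset.sum_insert hk]
        rw [e]
        have h7 := pow_le_pow_left₀ (norm_nonneg _)
          (norm_sub_le (expSum ω (insert k s) x t) (expSum ω s x t)) 2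
        nlinarith [sq_nonneg (‖expSum ω (insert k s) x t‖ - ‖expSum ω s x t‖)]
      have i1 : IntegrableOn (fun t => 2 * ‖expSum ω (insert k s) x t‖ ^ 2)
          (ball (0 : EuclideanSpace ℝ (Fin N)) (ρ + δ)) :=
        Continuous.integrableOn_ball_zero (by fun_prop) _
      have i2 : IntegrableOn (fun t => 2 * ‖expSum ω s x t‖ ^ 2)
          (ball (0 : EuclideanSpace ℝ (Fin N)) (ρ + δ)) :=
        Continuous.integrableOn_ball_zero (by fun_prop) _
      have h8 := setIntegral_mono (Continuous.integrableOn_ball_zero (by fun_prop) (ρ + δ))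
        (show IntegrableOn (fun t => 2 * ‖expSum ω (insert k s) x t‖ ^ 2
          + 2 * ‖expSum ω s x t‖ ^ 2) _ from i1.add i2) h6
      rw [integral_add i1 i2, integral_const_mul, integral_const_mul,
        integral_ball_norm_mul_wave_sq, ← hI] at h8
      have h9 := (integral_ball_mono_radius (continuous_expSum ω s x)
        (show ρ + δ ≤ 2 * T by linarith)).trans (hup ω s hgap x)
      have h10 : V * ‖x k‖ ^ 2 ≤ volume.real (ball (0 : EuclideanSpace ℝ (Fin N)) (ρ + δ))
          * ‖x k‖ ^ 2 := by
        gcongr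
        exact volume_real_ball_mono (by linarith)
      linarith
    calc b * δ ^ 3 * V * ‖x k‖ ^ 2 = b * δ ^ 3 * (V * ‖x k‖ ^ 2) := by ring
      _ ≤ b * δ ^ 3 * (2 * I + 2 * (C * S)) := by gcongr
      _ = 2 * b * δ ^ 3 * I + 2 * C * (b * δ ^ 3 * S) := by ring
      _ ≤ 2 * b * T ^ 3 * I + 2 * C * (30 * N * I) := by gcongr
      _ ≤ D * I := by
        have : 0 ≤ 30 * N * I := by positivity
        rw [hD]; linarith
  have hDI : 30 * N * I ≤ D * I := by
    have : 0 ≤ 2 * b * T ^ 3 + 60 * C * N := by positivity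
    gcongr
    linarith
  intro n hn
  rw [div_mul_eq_mul_div, div_mul_eq_mul_div, div_le_iff₀ hD0, mul_comm I]
  rcases Finset.mem_insert.1 hn with rfl | hn
  · refine le_trans ?_ h4
    have := min_le_right 1 V
    calc b * min 1 V * δ ^ 3 * ‖x n‖ ^ 2 ≤ b * V * δ ^ 3 * ‖x n‖ ^ 2 := by gcongr
      _ = _ := by ring
  · refine le_trans ?_ (h3.trans hDI)
    have h11 : ‖x n‖ ^ 2 ≤ S :=
      Finset.single_le_sum (f := fun k => ‖x k‖ ^ 2) (fun _ _ => by positivity) hn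
    have := min_le_left 1 V
    calc b * min 1 V * δ ^ 3 * ‖x n‖ ^ 2 ≤ b * 1 * δ ^ 3 * S := by gcongr
      _ = _ := by ring

/-- A coefficient bound survives the addition of a family with gap `G`, if the radius is increased
by slightly more than the critical radius of the family; the constant loses a factor `δ ^ 3`. -/
lemma exists_coefficient_bound_union (hN : 1 ≤ N) (hμ : 0 < firstDirichletEigenvalue N)
    {G : ℝ≥0∞} (hG : G ≠ 0) {γ T : ℝ} (hγ : 0 < γ) (hT : 0 < T) (hGT : criticalRadius N G ≤ T) :
    ∃ κ : ℝ, 0 < κ ∧ ∀ {K : Type*} [DecidableEq K] (ω : K → EuclideanSpace ℝ (Fin N))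
      (s₁ s₂ : Finset K) (k : K), Disjoint s₁ s₂ → k ∈ s₁ →
      (∀ k ∈ s₂, ∀ n ∈ s₂, k ≠ n → G ≤ ENNReal.ofReal ‖ω k - ω n‖) →
      (∀ n ∈ s₂, γ ≤ ‖ω n - ω k‖) → ∀ δ, 0 < δ → δ ≤ T → ∀ ρ B : ℝ, 0 ≤ B →
      (∀ x : K → ℂ, B * ‖x k‖ ^ 2
        ≤ ∫ t in ball (0 : EuclideanSpace ℝ (Fin N)) ρ, ‖expSum ω s₁ x t‖ ^ 2) →
      ∀ x : K → ℂ, B * (κ * δ ^ 3) * ‖x k‖ ^ 2 ≤ ∫ t in ball (0 : EuclideanSpace ℝ (Fin N))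
          (ρ + (criticalRadius N G + δ)), ‖expSum ω (s₁ ∪ s₂) x t‖ ^ 2 := by
  have hpi := Real.pi_pos
  by_cases hGt : G = ∞
  · subst hGt
    set c := min γ (Real.pi / T) with hc
    have hc0 : 0 < c := by positivity
    refine ⟨min (c ^ 2 / (T * Real.pi ^ 2)) (1 / T ^ 3), by positivity, ?_⟩
    intro K _ ω s₁ s₂ k hdisj hk hgap hgapk δ hδ hδT ρ B hB0 hB x
    rw [criticalRadius_top, zero_add]
    set κ := min (c ^ 2 / (T * Real.pi ^ 2)) (1 / T ^ 3) with hκ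
    rcases s₂.eq_empty_or_nonempty with rfl | ⟨n, hn⟩
    · rw [Finset.union_empty]
      refine le_trans ?_ ((hB x).trans
        (integral_ball_mono_radius (continuous_expSum _ _ _) (by linarith)))
      have h1 : κ * δ ^ 3 ≤ 1 := by
        calc κ * δ ^ 3 ≤ 1 / T ^ 3 * T ^ 3 := by gcongr; exact min_le_right _ _
          _ = 1 := by field_simp
      have h2 := mul_le_mul_of_nonneg_left h1 (show 0 ≤ B * ‖x k‖ ^ 2 by positivity)
      linarith
    · have hs : s₂ = {n} := by
        refine Finset.eq_singleton_iff_unique_mem.2 ⟨hn, fun l hl => ?_⟩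
        by_contra hnl
        exact absurd (hgap l hl n hn hnl) (by simp)
      subst hs
      have hns : n ∉ s₁ := fun h => Finset.disjoint_left.1 hdisj h hn
      have h1 := norm_sq_le_of_insert ω hns hB0 hδ hγ
        (by rw [norm_sub_rev]; exact hgapk n hn) hB x
      rw [Finset.union_comm, ← Finset.insert_eq]
      have h2 : c * δ ≤ min (δ * γ) Real.pi := by
        refine le_min ?_ ?_
        · rw [mul_comm]; gcongr; exact min_le_left _ _
        · calc c * δ ≤ Real.pi / T * T := by gcongr; exact min_le_right _ _
            _ = Real.pi := by field_simp
      have h3 : κ * δ ^ 3 * Real.pi ^ 2 ≤ (c * δ) ^ 2 := by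
        calc κ * δ ^ 3 * Real.pi ^ 2 = κ * δ ^ 2 * δ * Real.pi ^ 2 := by ring
          _ ≤ c ^ 2 / (T * Real.pi ^ 2) * δ ^ 2 * T * Real.pi ^ 2 := by
            gcongr; exact min_le_left _ _
          _ = _ := by field_simp
      have h4 : (c * δ) ^ 2 ≤ (min (δ * γ) Real.pi) ^ 2 := by gcongr
      have h5 := mul_le_mul_of_nonneg_left (h3.trans h4) (show 0 ≤ B * ‖x k‖ ^ 2 by positivity)
      refine le_of_mul_le_mul_left ?_ (show 0 < Real.pi ^ 2 by positivity)
      linarith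
  · obtain ⟨g, hg, rfl⟩ : ∃ g : ℝ, 0 < g ∧ G = ENNReal.ofReal g :=
      ⟨G.toReal, ENNReal.toReal_pos hG hGt, (ENNReal.ofReal_toReal hGt).symm⟩
    rw [criticalRadius_ofReal N hg] at hGT ⊢
    obtain ⟨κ, hκ, h⟩ := exists_coefficient_bound_insert hN hμ hg hγ hGT
    set V := volume.real (ball (0 : EuclideanSpace ℝ (Fin N)) (2 * T)) with hV
    have hV0 : 0 < V := volume_real_ball_pos (by positivity)
    refine ⟨κ / V, by positivity, ?_⟩
    intro K _ ω s₁ s₂ k hdisj hk hgap hgapk δ hδ hδT ρ B hB0 hB x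
    have h1 := norm_sq_le_of_union ω hdisj hk (show 0 < κ * δ ^ 3 by positivity)
      (h ω s₂ k (fun hk2 => Finset.disjoint_left.1 hdisj hk hk2) (fun k hk n hn hkn =>
        (ENNReal.ofReal_le_ofReal_iff (norm_nonneg _)).1 (hgap k hk n hn hkn)) hgapk δ hδ hδT)
      hB x
    have h2 := h1.trans (mul_le_mul_of_nonneg_right
      (volume_real_ball_mono (N := N)
        (show 2 * √(firstDirichletEigenvalue N) / g + δ ≤ 2 * T by linarith))
      (integral_nonneg fun _ => by positivity))
    rw [← hV] at h2
    have h3 : V * (B * (κ / V * δ ^ 3) * ‖x k‖ ^ 2) = κ * δ ^ 3 * B * ‖x k‖ ^ 2 := by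
      field_simp
    exact le_of_mul_le_mul_left (h3.trans_le h2) hV0

end Quantitative

/-! ### Partitioned families -/

section Partition

variable {N : ℕ}

lemma familyGap_le {K : Type*} (ω : K → EuclideanSpace ℝ (Fin N)) {S : Set K} {k n : K}
    (hk : k ∈ S) (hn : n ∈ S) (hkn : k ≠ n) : familyGap ω S ≤ ENNReal.ofReal ‖ω k - ω n‖ :=
  (iInf₂_le k hk).trans ((iInf₂_le n hn).trans (iInf_le _ hkn))

lemma familyGap_anti {K : Type*} (ω : K → EuclideanSpace ℝ (Fin N)) {S T : Set K} (h : S ⊆ T) :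
    familyGap ω T ≤ familyGap ω S :=
  le_iInf₂ fun _ hk => le_iInf₂ fun _ hn => le_iInf fun hkn => familyGap_le ω (h hk) (h hn) hkn

/-- Adding the families one after another to the family of `k`, with an excess `δ` of the radius
for each of them, gives a coefficient bound for the whole union. -/
lemma exists_coefficient_bound_partition {m : ℕ} (hN : 1 ≤ N)
    (hμ : 0 < firstDirichletEigenvalue N) {γ : ℝ} (hγ : 0 < γ) {γ' : Fin m → ℝ≥0∞}
    (hγ' : ∀ j, γ' j ≠ 0) {T : ℝ} (hT : 0 < T) (hγT : ∀ j, criticalRadius N (γ' j) ≤ T) :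
    ∃ κ : ℝ, 0 < κ ∧ ∀ {K : Type*} (ω : K → EuclideanSpace ℝ (Fin N)) (P : Fin m → Set K),
      (∀ i j, i ≠ j → Disjoint (P i) (P j)) → (⋃ j, P j) = Set.univ →
      (∀ k n, k ≠ n → γ ≤ ‖ω k - ω n‖) → (∀ j, γ' j ≤ familyGap ω (P j)) →
      ∀ δ, 0 < δ → δ ≤ T → ∀ (s : Finset K) (x : K → ℂ), ∀ k ∈ s,
        κ * δ ^ (N + 3 * (m - 1)) * ‖x k‖ ^ 2 ≤ ∫ t in ball (0 : EuclideanSpace ℝ (Fin N))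
          ((∑ j, criticalRadius N (γ' j)) + m * δ), ‖expSum ω s x t‖ ^ 2 := by
  choose κ₁ hκ₁ h₁ using fun j => exists_coefficient_bound hN hμ (hγ' j) hT (hγT j)
  choose κ₂ hκ₂ h₂ using fun j => exists_coefficient_bound_union hN hμ (hγ' j) hγ hT (hγT j)
  -- a common lower bound for all the constants
  obtain ⟨κ, hκ0, hκ₁', hκ₂'⟩ : ∃ κ : ℝ, 0 < κ ∧ (∀ j, κ ≤ κ₁ j) ∧ ∀ j, κ ≤ κ₂ j := by
    have e1 : ∀ᶠ κ in 𝓝[>] (0 : ℝ), ∀ j, κ ≤ κ₁ j := eventually_all.2 fun j =>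
      (eventually_le_nhds (hκ₁ j)).filter_mono nhdsWithin_le_nhds
    have e2 : ∀ᶠ κ in 𝓝[>] (0 : ℝ), ∀ j, κ ≤ κ₂ j := eventually_all.2 fun j =>
      (eventually_le_nhds (hκ₂ j)).filter_mono nhdsWithin_le_nhds
    obtain ⟨κ, h1, h2, h3⟩ := (e1.and (e2.and self_mem_nhdsWithin)).exists
    exact ⟨κ, h3, h1, h2⟩
  refine ⟨κ * κ ^ (m - 1), by positivity, ?_⟩
  intro K ω P hdisj hcover hgap hgap' δ hδ hδT s x k hks
  classical
  obtain ⟨i, hki⟩ : ∃ i, k ∈ P i := by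
    simpa using (hcover ▸ Set.mem_univ k : k ∈ ⋃ j, P j)
  have hfam : ∀ j, ∀ k ∈ P j, ∀ n ∈ P j, k ≠ n → γ' j ≤ ENNReal.ofReal ‖ω k - ω n‖ :=
    fun j k hk n hn hkn => (hgap' j).trans (familyGap_le ω hk hn hkn)
  have key : ∀ J : Finset (Fin m), i ∉ J → ∀ x : K → ℂ,
      κ * δ ^ N * (κ * δ ^ 3) ^ J.card * ‖x k‖ ^ 2 ≤ ∫ t in ball (0 : EuclideanSpace ℝ (Fin N))
        ((criticalRadius N (γ' i) + δ) + ∑ j ∈ J, (criticalRadius N (γ' j) + δ)),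
        ‖expSum ω (s.filter fun n => n ∈ P i ∨ ∃ j ∈ J, n ∈ P j) x t‖ ^ 2 := by
    intro J
    induction J using Finset.induction_on with
    | empty =>
      intro _ x
      simp only [Finset.card_empty, pow_zero, mul_one, Finset.sum_empty, add_zero,
        Finset.notMem_empty, false_and, exists_false, or_false]
      refine le_trans ?_ (h₁ i ω (s.filter fun n => n ∈ P i) (fun k hk n hn hkn =>
        hfam i k (Finset.mem_filter.1 hk).2 n (Finset.mem_filter.1 hn).2 hkn) δ hδ hδT x k
        (Finset.mem_filter.2 ⟨hks, hki⟩))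
      have := hκ₁' i
      gcongr
    | insert j J hj ih =>
      intro hi x
      rw [Finset.mem_insert, not_or] at hi
      have hsplit : (s.filter fun n => n ∈ P i ∨ ∃ l ∈ insert j J, n ∈ P l)
          = (s.filter fun n => n ∈ P i ∨ ∃ l ∈ J, n ∈ P l) ∪ s.filter fun n => n ∈ P j := by
        ext n
        simp only [Finset.mem_filter, Finset.mem_union, Finset.mem_insert]
        constructor
        · rintro ⟨hn, h | ⟨l, rfl | hl, h⟩⟩
          · exact Or.inl ⟨hn, Or.inl h⟩
          · exact Or.inr ⟨hn, h⟩
          · exact Or.inl ⟨hn, Or.inr ⟨l, hl, h⟩⟩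
        · rintro (⟨hn, h | ⟨l, hl, h⟩⟩ | ⟨hn, h⟩)
          · exact ⟨hn, Or.inl h⟩
          · exact ⟨hn, Or.inr ⟨l, Or.inr hl, h⟩⟩
          · exact ⟨hn, Or.inr ⟨j, Or.inl rfl, h⟩⟩
      have hd : Disjoint (s.filter fun n => n ∈ P i ∨ ∃ l ∈ J, n ∈ P l)
          (s.filter fun n => n ∈ P j) := by
        rw [Finset.disjoint_left]
        intro n hn hn'
        have hnj := (Finset.mem_filter.1 hn').2
        rcases (Finset.mem_filter.1 hn).2 with h | ⟨l, hl, h⟩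
        · exact Set.disjoint_left.1 (hdisj i j hi.1) h hnj
        · exact Set.disjoint_left.1 (hdisj l j (fun h => hj (h ▸ hl))) h hnj
      have hstep := h₂ j ω _ _ k hd (Finset.mem_filter.2 ⟨hks, Or.inl hki⟩)
        (fun k hk n hn hkn =>
          hfam j k (Finset.mem_filter.1 hk).2 n (Finset.mem_filter.1 hn).2 hkn)
        (fun n hn => hgap n k fun h => Set.disjoint_left.1 (hdisj i j hi.1) hki
          (h ▸ (Finset.mem_filter.1 hn).2)) δ hδ hδT _ _ (by positivity) (ih hi.2) x
      rw [hsplit, Finset.sum_insert hj, Finset.card_insert_of_notMem hj,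
        add_comm (criticalRadius N (γ' j) + δ), ← add_assoc]
      refine le_trans ?_ hstep
      rw [pow_succ, ← mul_assoc (κ * δ ^ N)]
      have := hκ₂' j
      gcongr
  have h3 := key (Finset.univ.erase i) (Finset.notMem_erase i _) x
  have hall : (s.filter fun n => n ∈ P i ∨ ∃ j ∈ Finset.univ.erase i, n ∈ P j) = s := by
    refine Finset.filter_true_of_mem fun n _ => ?_
    obtain ⟨j, hj⟩ : ∃ j, n ∈ P j := by
      simpa using (hcover ▸ Set.mem_univ n : n ∈ ⋃ j, P j)
    by_cases hji : j = i
    · exact Or.inl (hji ▸ hj)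
    · exact Or.inr ⟨j, Finset.mem_erase.2 ⟨hji, Finset.mem_univ j⟩, hj⟩
  rw [hall, Finset.add_sum_erase _ (fun j => criticalRadius N (γ' j) + δ) (Finset.mem_univ i),
    Finset.card_erase_of_mem (Finset.mem_univ i), Finset.card_univ, Fintype.card_fin,
    Finset.sum_add_distrib, Finset.sum_const, Finset.card_univ, Fintype.card_fin,
    nsmul_eq_mul] at h3
  refine le_trans (le_of_eq ?_) h3
  ring

end Partition

theorem theorem1p1 (N m : ℕ) (hN : 1 ≤ N) (hm : 1 ≤ m) (γ : ℝ≥0∞) (hγ : 0 < γ)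
    (γ' : Fin m → ℝ≥0∞) :
    ∃ c₁ c₂ : ℝ, 0 < c₁ ∧ 0 < c₂ ∧
      ∀ (K : Type*) (ω : K → EuclideanSpace ℝ (Fin N)) (P : Fin m → Set K),
        (∀ i j, i ≠ j → Disjoint (P i) (P j)) → (⋃ j, P j) = Set.univ →
        familyGap ω Set.univ = γ → (∀ j, familyGap ω (P j) = γ' j) →
        ∀ R : ℝ, (∑ j, criticalRadius N (γ' j)) < R →
          R ≤ 2 * ∑ j, criticalRadius N (γ' j) →
          ∀ x : K → ℂ, Summable (fun k => ‖x k‖ ^ 2) →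
            ∃ f : EuclideanSpace ℝ (Fin N) → ℂ,
              IsExpSumInL2 (ball 0 R) ω x f ∧
              c₁ * (R - ∑ j, criticalRadius N (γ' j)) ^ (5 * m - 4 + 2 * N) * ∑' k, ‖x k‖ ^ 2
                ≤ ∫ t in ball 0 R, ‖f t‖ ^ 2 ∧
              ∫ t in ball 0 R, ‖f t‖ ^ 2 ≤ c₂ * ∑' k, ‖x k‖ ^ 2 := by
  set R₀ := ∑ j, criticalRadius N (γ' j) with hR₀
  -- if `R₀ = 0`, no radius satisfies `R₀ < R ≤ 2 R₀`; otherwise `μ > 0` and `γ < ∞`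
  rcases (Finset.sum_nonneg fun j _ => criticalRadius_nonneg N (γ' j) : 0 ≤ R₀).eq_or_lt with
    hR0 | hpos
  · refine ⟨1, 1, one_pos, one_pos, ?_⟩
    intro K ω P _ _ _ _ R hR hR' x _
    linarith
  have hR0 : 0 < R₀ := hpos
  have hμ : 0 < firstDirichletEigenvalue N := by
    by_contra! h
    rw [hR₀, Finset.sum_eq_zero fun j _ =>
      criticalRadius_eq_zero_of_firstDirichletEigenvalue_nonpos h _] at hR0
    exact lt_irrefl _ hR0
  -- the gaps of the parts are at least `γ`
  by_cases hle : ∀ j, γ ≤ γ' j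
  swap
  · refine ⟨1, 1, one_pos, one_pos, ?_⟩
    intro K ω P _ _ h1 h2
    exact absurd (fun j => by
      rw [← h1, ← h2 j]; exact familyGap_anti ω (Set.subset_univ _)) hle
  have hγtop : γ ≠ ∞ := by
    rintro rfl
    rw [hR₀, Finset.sum_eq_zero fun j _ => by rw [top_le_iff.1 (hle j), criticalRadius_top]] at hR0
    exact lt_irrefl _ hR0
  have hγ0 : 0 < γ.toReal := ENNReal.toReal_pos hγ.ne' hγtop
  obtain ⟨κ, hκ, hlow⟩ := exists_coefficient_bound_partition hN hμ hγ0
    (fun j => (hγ.trans_le (hle j)).ne') hR0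
    (fun j => Finset.single_le_sum (f := fun j => criticalRadius N (γ' j))
      (fun j _ => criticalRadius_nonneg N (γ' j)) (Finset.mem_univ j))
  obtain ⟨C, hC, hup⟩ :=
    exists_integral_ball_expSum_le (E := EuclideanSpace ℝ (Fin N)) hγ0 (2 * R₀)
  set V := volume.real (ball (0 : EuclideanSpace ℝ (Fin N)) 1) with hV
  have hV0 : 0 < V := volume_real_ball_pos one_pos
  set p := N + 3 * (m - 1) + N with hp
  set M : ℝ := m + 1 with hM
  have hM0 : 0 < M := by positivity
  refine ⟨κ * V / (C * M ^ p * R₀ ^ (2 * m - 1)), C, by positivity, hC, ?_⟩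
  intro K ω P hdisj hcover hgap hgap' R hR hR' x hx
  have hsep : ∀ k n, k ≠ n → γ.toReal ≤ ‖ω k - ω n‖ := by
    intro k n hkn
    have := familyGap_le ω (Set.mem_univ k) (Set.mem_univ n) hkn
    rw [hgap] at this
    exact ENNReal.toReal_le_of_le_ofReal (norm_nonneg _) this
  have hupR : ∀ (r : ℝ), r ≤ 2 * R₀ → ∀ (s : Finset K) (x : K → ℂ),
      ∫ t in ball (0 : EuclideanSpace ℝ (Fin N)) r, ‖expSum ω s x t‖ ^ 2
        ≤ C * ∑ k ∈ s, ‖x k‖ ^ 2 := fun r hr s x =>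
    (integral_ball_mono_radius (continuous_expSum ω s x) hr).trans
      (hup ω s (fun k _ n _ hkn => hsep k n hkn) x)
  refine exists_isExpSumInL2_of_finite ω hC (hupR R hR') (fun s x => ?_) x hx
  -- the excess `R - R₀` is divided equally among the families and the final averaging
  set δ := (R - R₀) / M with hδ
  have hδ0 : 0 < δ := div_pos (by linarith) hM0
  have hRδ : R - R₀ = M * δ := by rw [hδ]; field_simp
  have hδR : δ ≤ R₀ := by
    have : 0 ≤ m * δ := by positivity
    have : R - R₀ = m * δ + δ := by rw [hRδ, hM]; ring
    linarith
  have h1 := sum_norm_sq_le_of_forall_norm_sq_le ω s hδ0 hC.le (hupR δ (by linarith) s)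
    (fun x k hk => hlow ω P hdisj hcover hsep (fun j => (hgap' j).ge) δ hδ0 hδR s x k hk) x
  have hrad : R₀ + m * δ + δ = R := by
    have : R - R₀ = m * δ + δ := by rw [hRδ, hM]; ring
    linarith
  rw [← hR₀, hrad, volume_real_ball_eq hδ0, ← hV] at h1
  set S := ∑ k ∈ s, ‖x k‖ ^ 2 with hS
  have hS0 : 0 ≤ S := Finset.sum_nonneg fun _ _ => by positivity
  have h2 : (R - R₀) ^ (5 * m - 4 + 2 * N) ≤ M ^ p * δ ^ p * R₀ ^ (2 * m - 1) := by
    have hexp : 5 * m - 4 + 2 * N = p + (2 * m - 1) := by omega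
    rw [hexp, pow_add, ← mul_pow, ← hRδ]
    have : 0 ≤ R - R₀ := by linarith
    gcongr
    linarith
  have h3 : κ * V / (C * M ^ p * R₀ ^ (2 * m - 1)) * (R - R₀) ^ (5 * m - 4 + 2 * N) * S
      ≤ κ * V / (C * M ^ p * R₀ ^ (2 * m - 1)) * (M ^ p * δ ^ p * R₀ ^ (2 * m - 1)) * S := by
    gcongr
  refine h3.trans (le_of_mul_le_mul_left (le_trans (le_of_eq ?_) h1) hC)
  rw [hp, pow_add δ]
  field_simp
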